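/- Let $\mathbb{F}$ be a field, some of whose elements are described by bit strings: $S\subseteq\{0,1\}^*$ is a set of strings, and $s\in S$ describes the element $\mathrm{val}(s)\in\mathbb{F}$. An algebraic circuit is a directed acyclic graph, given with its nodes in a topological order, whose leaves are labelled by variables or by constants $s\in S$, and whose internal nodes (of arbitrary fan-in $\geq 1$, wires counted with multiplicity) are labelled by $+$ or $\times$; its output is the last node. An ROABP in the order $\sigma\in S_n$ is a layered directed graph with layers $0,1,\dots,n$ of vertices, layers $0$ and $n$ having a single vertex each (the source and the sink), in which every edge from layer $i-1$ to layer $i$ is labelled by a univariate polynomial of degree at most $d$ in $x_{\sigma(i)}$. It computes the sum, over all source-to-sink paths, of the products of the labels along the path. Its width is the maximum number of vertices in a layer. The optimal ROABP-width of an $n$-variate polynomial $f$ of individual degree at most $d$ is the least width of an ROABP computing $f$, over all orders $\sigma$. For $\alpha\geq 1$, say that $\sigma$ is $\alpha$-approximate for $f$ if $f$ has an ROABP in the order $\sigma$ of width at most $\alpha$ times the optimal ROABP-width of $f$. An instance is a tuple $(C,n,d)$, where $n\geq 1$ and $d\geq 0$ are given in unary and $C$ is an algebraic circuit computing an $n$-variate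 polynomial $f$ over $\mathbb{F}$ of individual degree at most $d$. Algorithms are deterministic (multi-stack) Turing machines. **Theorem.** Let $\alpha>1$ be a constant. Suppose that there is a deterministic polynomial-time algorithm which, given any instance $(C,n,d)$, outputs an order that is $\alpha$-approximate for the polynomial computed by $C$. Then there are a constant $c$ (depending only on $\alpha$, for the given field and description of its constants) and a single deterministic algorithm which, given any instance $(C,n,d)$ and any rational $\varepsilon>0$ (numerator and denominator in binary), outputs an order that is $(1+\varepsilon)$-approximate for the polynomial computed by $C$, in time at most $m^{\,c\cdot\max(1,1/\varepsilon)}$, where $m$ is the length of the input $(C,n,d,\varepsilon)$. In particular, it runs in time $m^{O_\alpha(1/\varepsilon)}$ for $0<\varepsilon\leq 1$. -/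

import Mathlib

namespace OrderFinding

/-! ### Algebraic circuits -/

/-- A node of an algebraic circuit over the variables `x_0, …, x_{n-1}`, whose field constants are
given by labels from `S`. Internal nodes (`add`, `mul`) carry the list of the positions of their
children; a child that is repeated in the list is joined by several wires. -/
inductive Gate (S : Type) (n : ℕ) : Type where
  | var (i : Fin n)
  | const (c : S)
  | add (children : List ℕ)
  | mul (children : List ℕ)

/-- A node at position `j` is well formed if all its children stand at earlier positions, and if it
has at least one child in case it is internal. -/
def Gate.WellFormed {S : Type} {n : ℕ} (j : ℕ) : Gate S n → Prop
  | .var _ => True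
  | .const _ => True
  | .add l => l ≠ [] ∧ ∀ k ∈ l, k < j
  | .mul l => l ≠ [] ∧ ∀ k ∈ l, k < j

/-- An algebraic circuit: a directed acyclic graph with nodes of unbounded fan-in, described by
the list of its nodes in a topological order. Its output is the last node. -/
structure Circuit (S : Type) (n : ℕ) where
  gates : List (Gate S n)
  gates_ne_nil : gates ≠ []
  wellFormed : ∀ (j : ℕ) (hj : j < gates.length), (gates[j]).WellFormed j

/-- The polynomial computed at a node, given the list of those computed at the earlier nodes. -/
noncomputable def Gate.value {F : Type*} [Field F] {S : Type} {n : ℕ} (val : S → F)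
    (earlier : List (MvPolynomial (Fin n) F)) : Gate S n → MvPolynomial (Fin n) F
  | .var i => MvPolynomial.X i
  | .const c => MvPolynomial.C (val c)
  | .add l => (l.map fun k => earlier.getD k 0).sum
  | .mul l => (l.map fun k => earlier.getD k 0).prod

/-- The polynomials computed at all the nodes of a circuit, in the order of the nodes. -/
noncomputable def gateValues {F : Type*} [Field F] {S : Type} {n : ℕ} (val : S → F)
    (gates : List (Gate S n)) : List (MvPolynomial (Fin n) F) :=
  gates.foldl (fun earlier g => earlier ++ [g.value val earlier]) []

/-- The polynomial computed by a circuit, where the label `c` denotes the constant `val c`. -/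
noncomputable def Circuit.poly {F : Type*} [Field F] {S : Type} {n : ℕ} (val : S → F)
    (C : Circuit S n) : MvPolynomial (Fin n) F :=
  (gateValues val C.gates).getLastD 0

/-! ### Read-once oblivious algebraic branching programs -/

/-- A read-once oblivious algebraic branching program with `n + 1` layers of vertices, the first
and the last of which have a single vertex. The edges between layer `i` and layer `i + 1` are
labelled by univariate polynomials of degree at most `d`; the label `0` stands for an absent
edge. -/
structure ROABP (F : Type*) [Field F] (n d : ℕ) where
  layerSize : Fin (n + 1) → ℕ
  source : layerSize 0 = 1
  sink : layerSize (Fin.last n) = 1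
  weight : (i : Fin n) → Fin (layerSize i.castSucc) → Fin (layerSize i.succ) → Polynomial F
  natDegree_le : ∀ i u v, (weight i u v).natDegree ≤ d

/-- The width: the maximum number of vertices in a layer. -/
def ROABP.width {F : Type*} [Field F] {n d : ℕ} (R : ROABP F n d) : ℕ :=
  Finset.univ.sup R.layerSize

/-- The polynomial computed when the variables are read in the order `σ`: the sum, over all the
paths from the source to the sink, of the product of the labels along the path, where the label of
an edge between layers `i` and `i + 1` is evaluated at the variable `x_{σ i}`. -/
noncomputable def ROABP.poly {F : Type*} [Field F] {n d : ℕ} (R : ROABP F n d)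
    (σ : Equiv.Perm (Fin n)) : MvPolynomial (Fin n) F :=
  ∑ path : ((i : Fin (n + 1)) → Fin (R.layerSize i)),
    ∏ i : Fin n, Polynomial.aeval (MvPolynomial.X (σ i) : MvPolynomial (Fin n) F)
      (R.weight i (path i.castSucc) (path i.succ))

/-- `f` has an ROABP of width `w` in the order `σ` (with labels of degree at most `d`). -/
def HasROABP {F : Type*} [Field F] {n : ℕ} (d : ℕ) (f : MvPolynomial (Fin n) F)
    (σ : Equiv.Perm (Fin n)) (w : ℕ) : Prop :=
  ∃ R : ROABP F n d, R.poly σ = f ∧ R.width = w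

/-- `w` is the optimal ROABP-width of `f`, over all orders. -/
def IsOptimalWidth {F : Type*} [Field F] {n : ℕ} (d : ℕ) (f : MvPolynomial (Fin n) F)
    (w : ℕ) : Prop :=
  IsLeast {w' : ℕ | ∃ τ : Equiv.Perm (Fin n), HasROABP d f τ w'} w

/-- The order `σ` is within a factor `α` of optimal: `f` has an ROABP in the order `σ` whose width
is at most `α` times the optimal ROABP-width of `f`. -/
def IsApproxOrder {F : Type*} [Field F] {n : ℕ} (α : ℝ) (d : ℕ) (f : MvPolynomial (Fin n) F)
    (σ : Equiv.Perm (Fin n)) : Prop :=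
  ∃ wStar wOpt : ℕ, HasROABP d f σ wStar ∧ IsOptimalWidth d f wOpt ∧
    (wStar : ℝ) ≤ α * (wOpt : ℝ)

/-! ### Instances and their encodings as strings -/

/-- An input `(C, n, d)`. The labels of the constants are bit strings, taken from the set `S`. -/
structure Instance (S : Set (List Bool)) where
  n : ℕ
  d : ℕ
  C : Circuit S n

/-- The inputs that an algorithm has to deal with: there is at least one variable, and the
polynomial that the circuit computes has individual degree at most `d`. -/
def Instance.Valid {F : Type*} [Field F] {S : Set (List Bool)} (val : S → F)
    (I : Instance S) : Prop :=
  0 < I.n ∧ ∀ i : Fin I.n, (I.C.poly val).degreeOf i ≤ I.d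

/-- The alphabet in which inputs and outputs are written. -/
inductive Letter : Type where
  | tally
  | bit (b : Bool)
  | varTag
  | constTag
  | addTag
  | mulTag
  | item
  | endMark
  deriving DecidableEq

/-- A number in unary. -/
def encodeUnary (k : ℕ) : List Letter := List.replicate k Letter.tally

/-- A list of numbers, each in unary and preceded by the symbol `item`. -/
def encodeList (l : List ℕ) : List Letter := l.flatMap fun k => Letter.item :: encodeUnary k

def Gate.encode {S : Set (List Bool)} {n : ℕ} : Gate S n → List Letter
  | .var i => Letter.varTag :: encodeUnary i
  | .const c => Letter.constTag :: (c : List Bool).map Letter.bit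
  | .add l => Letter.addTag :: encodeList l
  | .mul l => Letter.mulTag :: encodeList l

/-- The input `(C, n, d)`, with `n` and `d` in unary. -/
def Instance.encode {S : Set (List Bool)} (I : Instance S) : List Letter :=
  I.C.gates.flatMap Gate.encode ++ [Letter.endMark] ++ encodeUnary I.n ++ [Letter.endMark] ++
    encodeUnary I.d ++ [Letter.endMark]

/-- The input `(C, n, d, ε)` for a positive rational number `ε`, given by its numerator and its
denominator in binary (the least significant bit comes first). -/
def Instance.encodeWithEps {S : Set (List Bool)} (I : Instance S) (ε : ℚ) : List Letter :=
  I.encode ++ (Nat.bits ε.num.toNat).map Letter.bit ++ [Letter.endMark] ++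
    (Nat.bits ε.den).map Letter.bit ++ [Letter.endMark]

/-- The output `σ`, as the list `σ 0, …, σ (n - 1)`. -/
def encodeOrder {n : ℕ} (σ : Equiv.Perm (Fin n)) : List Letter :=
  encodeList (List.ofFn fun i => (σ i : ℕ))

/-! ### Deterministic algorithms -/

/-- A deterministic algorithm: a multi-stack Turing machine (Mathlib's model) that reads and writes
strings over the alphabet `Letter`. -/
abbrev Algorithm : Type 1 := Turing.TM2ComputableAux Letter Letter

/-- On the input `x`, the algorithm halts after at most `t` steps with the output `y`. -/
def Algorithm.OutputsInTime (A : Algorithm) (x y : List Letter) (t : ℕ) : Prop :=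
  Nonempty (Turing.TM2OutputsInTime A.tm (x.map A.inputAlphabet.symm)
    (some (y.map A.outputAlphabet.symm)) t)

end OrderFinding

namespace OrderFinding

open Turing Function

/-! The proof amplifies by tensor powers. With `B = d + 1`, let `tensorPow B k f` be the product of
the polynomials `f(x^(B^j))` for `j < k`, each variable being raised to the power `B^j`. As `f` has
individual degree below `B`, an exponent of the product splits uniquely into digits in base `B`, and
its coefficient is the product of the coefficients of `f` at the digit vectors. For every
bipartition of the variables the coefficient matrix therefore becomes a `k`-fold Kronecker power,
and its rank is raised to the power `k` (`finrank_rowSpace_tensorPow`).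

By Nisan's characterisation, the least width in the order `σ` is the maximal rank over the prefixes
of `σ`, or 1 if `f = 0` (`HasROABP.finrank_le`, `exists_hasROABP`). So in every order the least
width of the product is the `k`-th power of that of `f`, and an `α`-approximate order for the
product is `α^(1/k)`-approximate for `f` (`IsApproxOrder.of_tensorPow`). By Bernoulli, `(1 + ε)^k ≥
1 + kε ≥ α` for some `k = O_α(max(1, 1/ε))`; a power of two read off from the bit lengths of the
numerator and denominator of `ε` will do (`le_one_add_pow`, `two_pow_le_max`).

The product has a circuit made of nodes for the powers of the variables, `k` copies of `C` with
redirected leaves, and a final product; with the degree bound `(d + 1)^k` in unary, the new input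
has length `m^(O(k))`. To obtain an actual machine, the reduction is written in a small loop
language whose semantics `Runs` carries time bounds. Programs are compiled to stack machines
(`Prog.Runs.reach`) and composed with the given algorithm (`compose_outputs`). The variables do not
change, so the order that is output needs no postprocessing. -/

instance : Fintype Letter where
  elems := {.tally, .bit true, .bit false, .varTag, .constTag, .addTag, .mulTag, .item, .endMark}
  complete a := by rcases a with _ | (_ | _) | _ | _ | _ | _ | _ | _ <;> simp

/-! ### A language of loop programs over registers that hold strings -/

/-- Programs over registers `R`, each of which holds a string. `each x body` runs `body a` for
every letter `a` of the register `x`, which it preserves; `consume x halts body` removes letters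
from `x` and runs `body` on them, up to (and excluding) a letter that satisfies `halts`, which is
removed as well. -/
inductive Prog (R : Type) : Type
  | skip
  | push (x : R) (a : Letter)
  | drop (x : R)
  | seq (p q : Prog R)
  | each (x : R) (body : Letter → Prog R)
  | consume (x : R) (halts : Letter → Bool) (body : Letter → Prog R)

/-- The relation `Step a`, which carries a time bound, applied for the letters `a` of a list in
turn, with two units of time spent on each of them. -/
inductive Iterates {X : Type} (Step : Letter → ℕ → X → X → Prop) :
    List Letter → ℕ → X → X → Prop
  | nil (s : X) : Iterates Step [] 0 s s
  | cons {a : Letter} {l : List Letter} {t₁ t₂ : ℕ} {s u s' : X} :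
      Step a t₁ s u → Iterates Step l t₂ u s' → Iterates Step (a :: l) (t₁ + 2 + t₂) s s'

namespace Prog

variable {R : Type} [DecidableEq R]

/-- The program turns the register contents `s` into `s'` in time at most `t`. -/
def Runs : Prog R → ℕ → (R → List Letter) → (R → List Letter) → Prop
  | skip, t, s, s' => s' = s ∧ 1 ≤ t
  | push x a, t, s, s' => s' = update s x (a :: s x) ∧ 1 ≤ t
  | drop x, t, s, s' => s' = update s x (s x).tail ∧ 1 ≤ t
  | seq p q, t, s, s' => ∃ t₁ t₂ u, p.Runs t₁ s u ∧ q.Runs t₂ u s' ∧ t₁ + t₂ ≤ t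
  | each x body, t, s, s' => ∃ t', Iterates (fun a => (body a).Runs) (s x) t' s s' ∧ t' + 2 ≤ t
  | consume x halts body, t, s, s' => ∃ t',
      Iterates (fun a => (body a).Runs) ((s x).takeWhile fun a => !halts a) t'
        (update s x ((s x).dropWhile fun a => !halts a).tail) s' ∧ t' + 1 ≤ t

/-- The register `x` is used by the program. -/
def Touches : Prog R → R → Prop
  | skip, _ => False
  | push y _, x => x = y
  | drop y, x => x = y
  | seq p q, x => p.Touches x ∨ q.Touches x
  | each y body, x => x = y ∨ ∃ a, (body a).Touches x
  | consume y _ body, x => x = y ∨ ∃ a, (body a).Touches x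

/-- No loop touches, in its body, the register that it runs over. -/
def Ok : Prog R → Prop
  | skip => True
  | push _ _ => True
  | drop _ => True
  | seq p q => p.Ok ∧ q.Ok
  | each y body => ∀ a, ¬ (body a).Touches y ∧ (body a).Ok
  | consume y _ body => ∀ a, ¬ (body a).Touches y ∧ (body a).Ok

theorem _root_.OrderFinding.Iterates.map {X Y : Type} {Step : Letter → ℕ → X → X → Prop}
    {Step' : Letter → ℕ → Y → Y → Prop} (φ : X → Y)
    (h : ∀ a t s s', Step a t s s' → Step' a t (φ s) (φ s')) {l : List Letter} {t : ℕ} {s s' : X}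
    (hi : Iterates Step l t s s') : Iterates Step' l t (φ s) (φ s') := by
  induction hi with
  | nil s => exact .nil _
  | cons h₁ _ ih => exact .cons (h _ _ _ _ h₁) ih

theorem _root_.OrderFinding.Iterates.preserves {X Y : Type} {Step : Letter → ℕ → X → X → Prop}
    (φ : X → Y) (h : ∀ a t s s', Step a t s s' → φ s' = φ s) {l : List Letter} {t : ℕ} {s s' : X}
    (hi : Iterates Step l t s s') : φ s' = φ s := by
  induction hi with
  | nil s => rfl
  | cons h₁ _ ih => rw [ih, h _ _ _ _ h₁]

theorem Runs.apply_eq {x : R} : ∀ {p : Prog R}, ¬ p.Touches x → ∀ {t : ℕ} {s s' : R → List Letter},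
    p.Runs t s s' → s' x = s x
  | skip, _, _, _, _, h => by rw [h.1]
  | push y a, hx, _, _, _, h => by
      rw [h.1, update_of_ne hx]
  | drop y, hx, _, _, _, h => by
      rw [h.1, update_of_ne hx]
  | seq p q, hx, _, _, _, ⟨_, _, _, h₁, h₂, _⟩ => by
      simp only [Touches, not_or] at hx
      rw [Runs.apply_eq hx.2 h₂, Runs.apply_eq hx.1 h₁]
  | each y body, hx, _, _, _, ⟨_, h, _⟩ => by
      simp only [Touches, not_or, not_exists] at hx
      exact h.preserves (fun s => s x) fun a _ _ _ h => Runs.apply_eq (hx.2 a) h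
  | consume y halts body, hx, _, _, _, ⟨_, h, _⟩ => by
      simp only [Touches, not_or, not_exists] at hx
      rw [h.preserves (fun s => s x) fun a _ _ _ h => Runs.apply_eq (hx.2 a) h,
        update_of_ne hx.1]

/-- While a compiled loop runs, the stack of its register passes through intermediate contents,
whereas `Runs` keeps that register fixed throughout the loop. As the body does not touch it, the run
of the body can be transported to any other contents. -/
theorem Runs.frame {x : R} (c : List Letter) :
    ∀ {p : Prog R}, ¬ p.Touches x → ∀ {t : ℕ} {s s' : R → List Letter},
      p.Runs t s s' → p.Runs t (update s x c) (update s' x c)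
  | skip, _, _, _, _, h => ⟨by rw [h.1], h.2⟩
  | push y a, hx, _, _, _, h => ⟨by
      rw [h.1, update_comm (Ne.symm hx), update_of_ne (Ne.symm hx)], h.2⟩
  | drop y, hx, _, _, _, h => ⟨by
      rw [h.1, update_comm (Ne.symm hx), update_of_ne (Ne.symm hx)], h.2⟩
  | seq p q, hx, _, _, _, ⟨t₁, t₂, u, h₁, h₂, h⟩ => by
      simp only [Touches, not_or] at hx
      exact ⟨t₁, t₂, Function.update u x c, h₁.frame c hx.1, h₂.frame c hx.2, h⟩
  | each y body, hx, _, _, _, ⟨t, h, ht⟩ => by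
      simp only [Touches, not_or, not_exists] at hx
      refine ⟨t, ?_, ht⟩
      rw [update_of_ne (Ne.symm hx.1)]
      exact h.map (fun s => Function.update s x c) fun a _ _ _ h => h.frame c (hx.2 a)
  | consume y halts body, hx, _, _, _, ⟨t, h, ht⟩ => by
      simp only [Touches, not_or, not_exists] at hx
      refine ⟨t, ?_, ht⟩
      rw [update_of_ne (Ne.symm hx.1), update_comm (Ne.symm (Ne.symm hx.1))]
      exact h.map (fun s => Function.update s x c) fun a _ _ _ h => h.frame c (hx.2 a)

/-- A run of time `t` makes no register longer by more than `t`. -/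
theorem Runs.length_le (x : R) : ∀ {p : Prog R} {t : ℕ} {s s' : R → List Letter},
    p.Runs t s s' → (s' x).length ≤ (s x).length + t := by
  have key : ∀ {body : Letter → Prog R} {l : List Letter} {t : ℕ} {s s' : R → List Letter},
      (∀ a, ∀ {t : ℕ} {s s' : R → List Letter}, (body a).Runs t s s' →
        (s' x).length ≤ (s x).length + t) →
      Iterates (fun a => (body a).Runs) l t s s' → (s' x).length ≤ (s x).length + t := by
    intro body l t s s' hb hi
    induction hi with
    | nil => simp
    | cons h₁ _ ih => have := hb _ h₁; omega
  intro p
  induction p with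
  | skip => rintro t s s' ⟨rfl, -⟩; omega
  | push y a =>
      rintro t s s' ⟨rfl, h⟩
      rcases eq_or_ne x y with rfl | hx
      · simp; omega
      · simp [update_of_ne hx]
  | drop y =>
      rintro t s s' ⟨rfl, h⟩
      rcases eq_or_ne x y with rfl | hx
      · simp; omega
      · simp [update_of_ne hx]
  | seq p q hp hq =>
      rintro t s s' ⟨t₁, t₂, u, h₁, h₂, h⟩
      have := hp h₁
      have := hq h₂
      omega
  | each y body ih =>
      rintro t s s' ⟨t', h, ht⟩
      have := key (fun a => ih a) h
      omega
  | consume y halts body ih =>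
      rintro t s s' ⟨t', h, ht⟩
      have h1 := key (fun a => ih a) h
      have h2 : (Function.update s y ((s y).dropWhile fun a => !halts a).tail x).length
          ≤ (s x).length := by
        rcases eq_or_ne x y with rfl | hx
        · have := (List.dropWhile_suffix (l := s x) (fun a => !halts a)).length_le
          simp only [update_self, List.length_tail]
          omega
        · simp [update_of_ne hx]
      omega

/-! ### Compilation -/

/-- The labels of the compiled program. -/
def Lab : Prog R → Type
  | skip => Unit
  | push _ _ => Unit
  | drop _ => Unit
  | seq p q => p.Lab ⊕ q.Lab
  | each _ body => Bool ⊕ (Σ a, (body a).Lab)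
  | consume _ _ body => Unit ⊕ (Σ a, (body a).Lab)

instance fintypeLab : (p : Prog R) → Fintype p.Lab
  | skip => inferInstanceAs (Fintype Unit)
  | push _ _ => inferInstanceAs (Fintype Unit)
  | drop _ => inferInstanceAs (Fintype Unit)
  | seq p q =>
      have := fintypeLab p
      have := fintypeLab q
      inferInstanceAs (Fintype (p.Lab ⊕ q.Lab))
  | each _ body =>
      have := fun a => fintypeLab (body a)
      inferInstanceAs (Fintype (Bool ⊕ (Σ a, (body a).Lab)))
  | consume _ _ body =>
      have := fun a => fintypeLab (body a)
      inferInstanceAs (Fintype (Unit ⊕ (Σ a, (body a).Lab)))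

/-- The label at which the compiled program starts. -/
def entry : (p : Prog R) → p.Lab
  | skip => ()
  | push _ _ => ()
  | drop _ => ()
  | seq p _ => Sum.inl p.entry
  | each _ _ => Sum.inl false
  | consume _ _ _ => Sum.inl ()

section Machine

variable {K Λ σ : Type} [DecidableEq K] {Γ : K → Type}

/-- The alphabets of a machine that has two stacks for each register, the second of which is
auxiliary, next to the stacks `K`. -/
abbrev Alph (R : Type) (Γ : K → Type) : (R × Bool) ⊕ K → Type
  | Sum.inl _ => Letter
  | Sum.inr k => Γ k

/-- The contents of all the stacks. -/
def contents (s aux : R → List Letter) (T : ∀ k, List (Γ k)) :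
    ∀ k : (R × Bool) ⊕ K, List (Alph R Γ k)
  | Sum.inl (x, false) => s x
  | Sum.inl (x, true) => aux x
  | Sum.inr k => T k

theorem update_contents_reg (s aux : R → List Letter) (T : ∀ k, List (Γ k)) (x : R)
    (l : List Letter) :
    Function.update (contents s aux T) (Sum.inl (x, false)) l
      = contents (Function.update s x l) aux T := by
  funext k
  rcases k with ⟨y, _ | _⟩ | k
  · rcases eq_or_ne y x with rfl | h
    · simp [contents]
    · rw [update_of_ne (by simpa using h)]; simp [contents, h]
  · rw [update_of_ne (by simp)]; rfl
  · rw [update_of_ne (by simp)]; rfl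

theorem update_contents_aux (s aux : R → List Letter) (T : ∀ k, List (Γ k)) (x : R)
    (l : List Letter) :
    Function.update (contents s aux T) (Sum.inl (x, true)) l
      = contents s (Function.update aux x l) T := by
  funext k
  rcases k with ⟨y, _ | _⟩ | k
  · rw [update_of_ne (by simp)]; rfl
  · rcases eq_or_ne y x with rfl | h
    · simp [contents]
    · rw [update_of_ne (by simpa using h)]; simp [contents, h]
  · rw [update_of_ne (by simp)]; rfl

theorem update_contents_inr (s aux : R → List Letter) (T : ∀ k, List (Γ k)) (k : K)
    (l : List (Γ k)) :
    Function.update (contents s aux T) (Sum.inr k) l = contents s aux (Function.update T k l) := by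
  funext k'
  rcases k' with ⟨y, _ | _⟩ | k'
  · rw [update_of_ne (by simp)]; rfl
  · rw [update_of_ne (by simp)]; rfl
  · rcases eq_or_ne k' k with rfl | h
    · simp [contents]
    · rw [update_of_ne (by simpa using h)]; simp [contents, h]

/-- The statements of the compiled program, whose labels are named by `L`, and which goes on at
the label `exit`. -/
def code : (p : Prog R) → (p.Lab → Λ) → Λ → p.Lab → TM2.Stmt (Alph R Γ) Λ (Option Letter × σ)
  | skip, _, exit, _ => .goto fun _ => exit
  | push x a, _, exit, _ => .push (Sum.inl (x, false)) (fun _ => a) (.goto fun _ => exit)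
  | drop x, _, exit, _ => .pop (Sum.inl (x, false)) (fun v _ => v) (.goto fun _ => exit)
  | seq p q, L, _exit, Sum.inl l => p.code (fun l => L (Sum.inl l)) (L (Sum.inr q.entry)) l
  | seq _ q, L, exit, Sum.inr l => q.code (fun l => L (Sum.inr l)) exit l
  | each x body, L, _exit, Sum.inl false =>
      .pop (Sum.inl (x, false)) (fun v o => (o, v.2)) <|
        .branch (fun v => v.1.isSome)
          (.push (Sum.inl (x, true)) (fun v => v.1.getD .tally)
            (.goto fun v => L (Sum.inr ⟨v.1.getD .tally, (body (v.1.getD .tally)).entry⟩)))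
          (.goto fun _ => L (Sum.inl true))
  | each x _, L, exit, Sum.inl true =>
      .pop (Sum.inl (x, true)) (fun v o => (o, v.2)) <|
        .branch (fun v => v.1.isSome)
          (.push (Sum.inl (x, false)) (fun v => v.1.getD .tally) (.goto fun _ => L (Sum.inl true)))
          (.goto fun _ => exit)
  | each _ body, L, _, Sum.inr ⟨a, l⟩ =>
      (body a).code (fun l => L (Sum.inr ⟨a, l⟩)) (L (Sum.inl false)) l
  | consume x halts body, L, exit, Sum.inl () =>
      .pop (Sum.inl (x, false)) (fun v o => (o, v.2)) <|
        .branch (fun v => v.1.any fun a => !halts a)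
          (.goto fun v => L (Sum.inr ⟨v.1.getD .tally, (body (v.1.getD .tally)).entry⟩))
          (.goto fun _ => exit)
  | consume _ _ body, L, _, Sum.inr ⟨a, l⟩ =>
      (body a).code (fun l => L (Sum.inr ⟨a, l⟩)) (L (Sum.inl ())) l

end Machine

end Prog

/-! ### Timed reachability between configurations -/

section Reach

variable {K Λ σ : Type} [DecidableEq K] {Γ : K → Type}

/-- The machine `M` gets from one configuration to the other in at most `t` steps. -/
def Reach (M : Λ → TM2.Stmt Γ Λ σ) (t : ℕ) (c c' : TM2.Cfg Γ Λ σ) : Prop :=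
  Nonempty (StateTransition.EvalsToInTime (TM2.step M) c (some c') t)

theorem Reach.refl (M : Λ → TM2.Stmt Γ Λ σ) (c : TM2.Cfg Γ Λ σ) : Reach M 0 c c :=
  ⟨.refl _ _⟩

theorem Reach.trans {M : Λ → TM2.Stmt Γ Λ σ} {t₁ t₂ : ℕ} {a b c : TM2.Cfg Γ Λ σ}
    (h₁ : Reach M t₁ a b) (h₂ : Reach M t₂ b c) : Reach M (t₁ + t₂) a c := by
  obtain ⟨h₁⟩ := h₁
  obtain ⟨h₂⟩ := h₂
  rw [add_comm]
  exact ⟨h₁.trans _ _ _ _ _ _ h₂⟩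

theorem Reach.mono {M : Λ → TM2.Stmt Γ Λ σ} {t₁ t₂ : ℕ} {a b : TM2.Cfg Γ Λ σ}
    (h₁ : Reach M t₁ a b) (h : t₁ ≤ t₂) : Reach M t₂ a b := by
  obtain ⟨h₁⟩ := h₁
  exact ⟨⟨h₁.toEvalsTo, h₁.steps_le_m.trans h⟩⟩

theorem Reach.step {M : Λ → TM2.Stmt Γ Λ σ} {l : Λ} {q : TM2.Stmt Γ Λ σ} (hM : M l = q) {v : σ}
    {S : ∀ k, List (Γ k)} {c : TM2.Cfg Γ Λ σ} (h : TM2.stepAux q v S = c) :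
    Reach M 1 ⟨some l, v, S⟩ c :=
  ⟨⟨⟨1, by subst h hM; rfl⟩, le_rfl⟩⟩

end Reach

end OrderFinding
namespace OrderFinding

open Turing Function

/-! ### Correctness of the compilation -/

namespace Prog

variable {R K : Type} {Γ : K → Type}

@[simp] theorem contents_reg (s aux : R → List Letter) (T : ∀ k, List (Γ k)) (x : R) :
    contents s aux T (Sum.inl (x, false)) = s x := rfl

@[simp] theorem contents_aux (s aux : R → List Letter) (T : ∀ k, List (Γ k)) (x : R) :
    contents s aux T (Sum.inl (x, true)) = aux x := rfl

@[simp] theorem contents_inr (s aux : R → List Letter) (T : ∀ k, List (Γ k)) (k : K) :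
    contents s aux T (Sum.inr k) = T k := rfl

variable [DecidableEq R] [DecidableEq K] {Λ σ : Type}

/-- The second phase of a compiled `each`: the traversed letters were saved in reverse on the
auxiliary stack, and pouring them back reverses them again, so that `each` preserves its register.
-/
theorem reach_restore (M : Λ → TM2.Stmt (Alph R Γ) Λ (Option Letter × σ)) {x : R} {l₀ exit : Λ}
    (hM : M l₀ = .pop (Sum.inl (x, true)) (fun v o => (o, v.2))
        (.branch (fun v => v.1.isSome)
          (.push (Sum.inl (x, false)) (fun v => v.1.getD .tally) (.goto fun _ => l₀))
          (.goto fun _ => exit)))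
    (T : ∀ k, List (Γ k)) (s aux : R → List Letter) (l : List Letter) :
    ∀ (acc : List Letter) (v : Option Letter × σ),
      Reach M (l.length + 1) ⟨some l₀, v, contents (update s x acc) (update aux x l) T⟩
        ⟨some exit, (none, v.2),
          contents (update s x (l.reverse ++ acc)) (update aux x []) T⟩ := by
  induction l with
  | nil =>
      intro acc v
      apply Reach.step hM
      simp [update_contents_aux]
  | cons a l ih =>
      intro acc v
      have h1 : Reach M 1 ⟨some l₀, v, contents (update s x acc) (update aux x (a :: l)) T⟩
          ⟨some l₀, (some a, v.2), contents (update s x (a :: acc)) (update aux x l) T⟩ := by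
        apply Reach.step hM
        simp [update_contents_aux, update_contents_reg]
      have h2 := h1.trans (ih (a :: acc) (some a, v.2))
      rw [List.reverse_cons, List.append_assoc]
      exact h2.mono (by simp; omega)

/-- The compiled program does what `Runs` says. -/
theorem Runs.reach (M : Λ → TM2.Stmt (Alph R Γ) Λ (Option Letter × σ)) (T : ∀ k, List (Γ k)) :
    ∀ (p : Prog R) (L : p.Lab → Λ) (exit : Λ), (∀ l, M (L l) = p.code L exit l) → p.Ok →
      ∀ {t : ℕ} {s s' : R → List Letter}, p.Runs t s s' →
      ∀ (v : Option Letter × σ) (aux : R → List Letter), (∀ x, p.Touches x → aux x = []) →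
      ∃ o, Reach M t ⟨some (L p.entry), v, contents s aux T⟩
        ⟨some exit, (o, v.2), contents s' aux T⟩ := by
  intro p
  induction p with
  | skip =>
      rintro L exit hM - t s s' ⟨rfl, ht⟩ v aux -
      refine ⟨v.1, (Reach.step (hM _) ?_).mono ht⟩
      simp [code]
  | push x a =>
      rintro L exit hM - t s s' ⟨rfl, ht⟩ v aux -
      refine ⟨v.1, (Reach.step (hM _) ?_).mono ht⟩
      simp [code, update_contents_reg]
  | drop x =>
      rintro L exit hM - t s s' ⟨rfl, ht⟩ v aux -
      refine ⟨v.1, (Reach.step (hM _) ?_).mono ht⟩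
      simp [code, update_contents_reg]
  | seq p q hp hq =>
      rintro L exit hM ⟨okp, okq⟩ t s s' ⟨t₁, t₂, u, h₁, h₂, ht⟩ v aux haux
      obtain ⟨o₁, r₁⟩ := hp (fun l => L (Sum.inl l)) (L (Sum.inr q.entry))
        (fun l => hM (Sum.inl l)) okp h₁ v aux fun x hx => haux x (Or.inl hx)
      obtain ⟨o₂, r₂⟩ := hq (fun l => L (Sum.inr l)) exit
        (fun l => hM (Sum.inr l)) okq h₂ (o₁, v.2) aux fun x hx => haux x (Or.inr hx)
      exact ⟨o₂, (r₁.trans r₂).mono ht⟩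
  | each x body ih =>
      rintro L exit hM ok t s s' ⟨t', h, ht⟩ v aux haux
      -- Invariant of the first phase: the letters to come are on the stack of the register, those
      -- already treated are reversed on the auxiliary stack. Of the two units that `Iterates`
      -- charges per letter, one pays for this phase and one for the restoring phase; hence `t -
      -- l.length + 1`.
      have key : ∀ {l : List Letter} {t : ℕ} {s s' : R → List Letter},
          Iterates (fun a => (body a).Runs) l t s s' → ∀ (done : List Letter)
          (v : Option Letter × σ), ∃ o, Reach M (t - l.length + 1)
            ⟨some (L (Sum.inl false)), v, contents (Function.update s x l)
              (Function.update aux x done) T⟩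
            ⟨some (L (Sum.inl true)), (o, v.2), contents (Function.update s' x [])
              (Function.update aux x (l.reverse ++ done)) T⟩ ∧ l.length ≤ t := by
        intro l t s s' hi
        induction hi with
        | nil s =>
            intro done v
            refine ⟨none, Reach.step (hM (Sum.inl false)) ?_, le_rfl⟩
            simp [code, update_contents_reg]
        | @cons a l t₁ t₂ s u s' h₁ _ ih' =>
            intro done v
            have r₁ : Reach M 1 ⟨some (L (Sum.inl false)), v, contents
                (Function.update s x (a :: l)) (Function.update aux x done) T⟩
                ⟨some (L (Sum.inr ⟨a, (body a).entry⟩)), (some a, v.2), contents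
                  (Function.update s x l) (Function.update aux x (a :: done)) T⟩ := by
              apply Reach.step (hM (Sum.inl false))
              simp [code, update_contents_reg, update_contents_aux]
            obtain ⟨o₂, r₂⟩ := ih a (fun l => L (Sum.inr ⟨a, l⟩)) (L (Sum.inl false))
              (fun l => hM (Sum.inr ⟨a, l⟩)) (ok a).2 (h₁.frame l (ok a).1) (some a, v.2)
              (Function.update aux x (a :: done)) (by
                intro y hy
                rw [update_of_ne (by rintro rfl; exact (ok a).1 hy)]
                exact haux y (Or.inr ⟨a, hy⟩))
            obtain ⟨o₃, r₃, hl⟩ := ih' (a :: done) (o₂, v.2)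
            refine ⟨o₃, ?_, by simp; omega⟩
            rw [List.reverse_cons, List.append_assoc]
            exact (r₁.trans (r₂.trans r₃)).mono (by simp; omega)
      obtain ⟨o, r₁, hl⟩ := key h [] v
      have hx : s' x = s x := h.preserves (fun s => s x) fun a _ _ _ h => h.apply_eq (ok a).1
      have r₂ := reach_restore M (hM (Sum.inl true)) T s' aux (s x).reverse [] (o, v.2)
      have haux' : Function.update aux x [] = aux := by
        rw [← haux x (Or.inl rfl), update_eq_self]
      rw [List.append_nil, haux', update_eq_self] at r₁
      rw [List.append_nil, haux', List.reverse_reverse, ← hx, update_eq_self, hx] at r₂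
      exact ⟨none, (r₁.trans r₂).mono (by simp; omega)⟩
  | consume x halts body ih =>
      rintro L exit hM ok t s s' ⟨t', h, ht⟩ v aux haux
      -- Here `l` is still to be consumed, and `r` is empty or starts with the halting letter. The
      -- last pop removes that letter, which is why `r.tail` remains.
      have key : ∀ {l : List Letter} {t : ℕ} {s s' : R → List Letter},
          Iterates (fun a => (body a).Runs) l t s s' → (∀ a ∈ l, halts a = false) →
          ∀ (r : List Letter), (∀ a ∈ r.head?, halts a = true) → ∀ (v : Option Letter × σ),
          ∃ o, Reach M (t + 1)
            ⟨some (L (Sum.inl ())), v, contents (Function.update s x (l ++ r)) aux T⟩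
            ⟨some exit, (o, v.2), contents (Function.update s' x r.tail) aux T⟩ := by
        intro l t s s' hi
        induction hi with
        | nil s =>
            intro _ r hr v
            refine ⟨r.head?, Reach.step (hM (Sum.inl ())) ?_⟩
            cases r with
            | nil => simp [code, update_contents_reg]
            | cons b r =>
              have hb : halts b = true := hr b rfl
              simp [code, update_contents_reg, hb]
        | @cons a l t₁ t₂ s u s' h₁ _ ih' =>
            intro hs r hr v
            have ha : halts a = false := hs a (by simp)
            have r₁ : Reach M 1 ⟨some (L (Sum.inl ())), v, contents
                (Function.update s x (a :: l ++ r)) aux T⟩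
                ⟨some (L (Sum.inr ⟨a, (body a).entry⟩)), (some a, v.2), contents
                  (Function.update s x (l ++ r)) aux T⟩ := by
              apply Reach.step (hM (Sum.inl ()))
              simp [code, update_contents_reg, ha]
            obtain ⟨o₂, r₂⟩ := ih a (fun l => L (Sum.inr ⟨a, l⟩)) (L (Sum.inl ()))
              (fun l => hM (Sum.inr ⟨a, l⟩)) (ok a).2 (h₁.frame (l ++ r) (ok a).1) (some a, v.2)
              aux fun y hy => haux y (Or.inr ⟨a, hy⟩)
            obtain ⟨o₃, r₃⟩ := ih' (fun b hb => hs b (by simp [hb])) r hr (o₂, v.2)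
            exact ⟨o₃, (r₁.trans (r₂.trans r₃)).mono (by omega)⟩
      obtain ⟨o, r⟩ := key h (fun a ha => by simpa using List.mem_takeWhile_imp ha)
        ((s x).dropWhile fun a => !halts a) (fun a ha => by
          have := List.head?_dropWhile_not (fun a => !halts a) (s x)
          rw [Option.mem_def] at ha
          simpa [ha] using this) v
      have hx : s' x = ((s x).dropWhile fun a => !halts a).tail := by
        rw [h.preserves (fun s => s x) fun a _ _ _ h => h.apply_eq (ok a).1, update_self]
      rw [List.takeWhile_append_dropWhile, update_idem, update_eq_self, ← hx, update_eq_self] at r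
      exact ⟨o, r.mono ht⟩

end Prog

end OrderFinding
namespace OrderFinding

open Turing Function

/-! ### Embedding a machine among further stacks -/

section Lift

variable {R K : Type} {Γ : K → Type} {Λ Λ₂ σ : Type}

/-- The statement of a machine, as a statement of a machine with further stacks. -/
def liftStmt (R : Type) (L : Λ₂ → Λ) :
    TM2.Stmt Γ Λ₂ σ → TM2.Stmt (Prog.Alph R Γ) Λ (Option Letter × σ)
  | .push k f q => .push (Sum.inr k) (fun v => f v.2) (liftStmt R L q)
  | .peek k f q => .peek (Sum.inr k) (fun v o => (v.1, f v.2 o)) (liftStmt R L q)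
  | .pop k f q => .pop (Sum.inr k) (fun v o => (v.1, f v.2 o)) (liftStmt R L q)
  | .load f q => .load (fun v => (v.1, f v.2)) (liftStmt R L q)
  | .branch f q₁ q₂ => .branch (fun v => f v.2) (liftStmt R L q₁) (liftStmt R L q₂)
  | .goto f => .goto fun v => L (f v.2)
  | .halt => .halt

/-- The configuration of a machine, as a configuration of a machine with further stacks, all of
which are empty. -/
def liftCfg (R : Type) (L : Λ₂ → Λ) (c : TM2.Cfg Γ Λ₂ σ) :
    TM2.Cfg (Prog.Alph R Γ) Λ (Option Letter × σ) :=
  ⟨c.l.map L, (none, c.var), Prog.contents (fun _ => []) (fun _ => []) c.stk⟩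

variable [DecidableEq R] [DecidableEq K]

theorem stepAux_liftStmt (L : Λ₂ → Λ) (q : TM2.Stmt Γ Λ₂ σ) :
    ∀ (v : σ) (T : ∀ k, List (Γ k)),
      TM2.stepAux (liftStmt R L q) (none, v) (Prog.contents (fun _ => []) (fun _ => []) T)
        = liftCfg R L (TM2.stepAux q v T) := by
  induction q with
  | push k f q ih => intro v T; simp [liftStmt, Prog.update_contents_inr, ih]
  | peek k f q ih => intro v T; simp [liftStmt, ih]
  | pop k f q ih => intro v T; simp [liftStmt, Prog.update_contents_inr, ih]
  | load f q ih => intro v T; simp [liftStmt, ih]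
  | branch f q₁ q₂ ih₁ ih₂ =>
      intro v T
      simp only [liftStmt, TM2.stepAux, ih₁, ih₂]
      cases f v <;> rfl
  | goto f => intro v T; rfl
  | halt => intro v T; rfl

theorem step_lift {M : Λ → TM2.Stmt (Prog.Alph R Γ) Λ (Option Letter × σ)}
    {M₂ : Λ₂ → TM2.Stmt Γ Λ₂ σ} {L : Λ₂ → Λ} (hM : ∀ l, M (L l) = liftStmt R L (M₂ l))
    (c : TM2.Cfg Γ Λ₂ σ) :
    TM2.step M (liftCfg R L c) = (TM2.step M₂ c).map (liftCfg R L) := by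
  rcases c with ⟨_ | l, v, T⟩
  · rfl
  · simp only [liftCfg, Option.map_some, TM2.step, hM]
    rw [stepAux_liftStmt]
    rfl

theorem Reach.lift {M : Λ → TM2.Stmt (Prog.Alph R Γ) Λ (Option Letter × σ)}
    {M₂ : Λ₂ → TM2.Stmt Γ Λ₂ σ} {L : Λ₂ → Λ} (hM : ∀ l, M (L l) = liftStmt R L (M₂ l))
    {t : ℕ} {c c' : TM2.Cfg Γ Λ₂ σ} (h : Reach M₂ t c c') :
    Reach M t (liftCfg R L c) (liftCfg R L c') := by
  obtain ⟨⟨n, h⟩, hn⟩ := h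
  refine ⟨⟨⟨n, ?_⟩, hn⟩⟩
  have key : ∀ (n : ℕ) (o : Option (TM2.Cfg Γ Λ₂ σ)),
      (flip bind (TM2.step M))^[n] (o.map (liftCfg R L))
        = ((flip bind (TM2.step M₂))^[n] o).map (liftCfg R L) := by
    intro n
    induction n with
    | zero => intro o; rfl
    | succ n ih =>
        intro o
        rw [iterate_succ_apply, iterate_succ_apply, ← ih]
        congr 1
        rcases o with _ | c
        · rfl
        · exact step_lift hM c
  exact (key n (some c)).trans (by rw [h]; rfl)

end Lift

theorem reach_transfer {R K Λ σ : Type} [DecidableEq R] [DecidableEq K] {Γ : K → Type}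
    {M : Λ → TM2.Stmt (Prog.Alph R Γ) Λ (Option Letter × σ)} {out : R} {k : K} {l₀ exit : Λ}
    (e : Letter → Γ k)
    (hM : M l₀ = .pop (Sum.inl (out, false)) (fun v o => (o, v.2))
      (.branch (fun v => v.1.isSome)
        (.push (Sum.inr k) (fun v => e (v.1.getD .tally)) (.goto fun _ => l₀))
        (.goto fun _ => exit))) (T : ∀ k, List (Γ k)) (y : List Letter) :
    ∀ (acc : List (Γ k)) (v : Option Letter × σ),
      Reach M (y.length + 1)
        ⟨some l₀, v, Prog.contents (update (fun _ => []) out y) (fun _ => []) (update T k acc)⟩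
        ⟨some exit, (none, v.2), Prog.contents (fun _ => []) (fun _ => [])
          (update T k ((y.map e).reverse ++ acc))⟩ := by
  induction y with
  | nil =>
      intro acc v
      apply Reach.step hM
      simp [Prog.update_contents_reg]
  | cons a y ih =>
      intro acc v
      have h1 : Reach M 1
          ⟨some l₀, v, Prog.contents (update (fun _ => []) out (a :: y)) (fun _ => [])
            (update T k acc)⟩
          ⟨some l₀, (some a, v.2), Prog.contents (update (fun _ => []) out y) (fun _ => [])
            (update T k (e a :: acc))⟩ := by
        apply Reach.step hM
        simp [Prog.update_contents_reg, Prog.update_contents_inr]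
      rw [List.map_cons, List.reverse_cons, List.append_assoc]
      exact (h1.trans (ih (e a :: acc) (some a, v.2))).mono (by simp; omega)

/-! ### A program followed by an algorithm -/

section Compose

variable {R : Type} [DecidableEq R] [Fintype R]

/-- The machine that runs the program `P` on the input, in the register `inp`, and then the
algorithm `A` on the reversal of the register `out`. -/
def composeTM (P : Prog R) (inp out : R) (A : Algorithm) : FinTM2 where
  K := (R × Bool) ⊕ A.tm.K
  kFin := by
    have := A.tm.kFin
    infer_instance
  k₀ := Sum.inl (inp, false)
  k₁ := Sum.inr A.tm.k₁
  Γ := Prog.Alph R A.tm.Γ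
  Λ := P.Lab ⊕ (Unit ⊕ A.tm.Λ)
  main := Sum.inl P.entry
  ΛFin := by
    have := A.tm.ΛFin
    infer_instance
  σ := Option Letter × A.tm.σ
  initialState := (none, A.tm.initialState)
  σFin := by
    have := A.tm.σFin
    infer_instance
  Γk₀Fin := inferInstanceAs (Fintype Letter)
  m
    | Sum.inl l => P.code Sum.inl (Sum.inr (Sum.inl ())) l
    | Sum.inr (Sum.inl ()) =>
        .pop (Sum.inl (out, false)) (fun v o => (o, v.2)) <|
          .branch (fun v => v.1.isSome)
            (.push (Sum.inr A.tm.k₀) (fun v => A.inputAlphabet.symm (v.1.getD .tally))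
              (.goto fun _ => Sum.inr (Sum.inl ())))
            (.goto fun _ => Sum.inr (Sum.inr A.tm.main))
    | Sum.inr (Sum.inr l) => liftStmt R (fun l => Sum.inr (Sum.inr l)) (A.tm.m l)

/-- The algorithm that runs a program, and then `A` on its output. -/
def compose (P : Prog R) (inp out : R) (A : Algorithm) : Algorithm where
  tm := composeTM P inp out A
  inputAlphabet := Equiv.refl Letter
  outputAlphabet := A.outputAlphabet

theorem initList_stk (tm : FinTM2) (l : List (tm.Γ tm.k₀)) :
    (initList tm l).stk = update (fun _ => []) tm.k₀ l := by
  funext k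
  by_cases h : k = tm.k₀
  · subst h
    simp [initList]
  · simp [initList, h]

theorem haltList_stk (tm : FinTM2) (l : List (tm.Γ tm.k₁)) :
    (haltList tm l).stk = update (fun _ => []) tm.k₁ l := by
  funext k
  by_cases h : k = tm.k₁
  · subst h
    simp [haltList]
  · simp [haltList, h]

theorem Algorithm.outputsInTime_iff (A : Algorithm) (x y : List Letter) (t : ℕ) :
    A.OutputsInTime x y t ↔ Reach A.tm.m t
      ⟨some A.tm.main, A.tm.initialState,
        update (fun _ => []) A.tm.k₀ (x.map A.inputAlphabet.symm)⟩
      ⟨none, A.tm.initialState, update (fun _ => []) A.tm.k₁ (y.map A.outputAlphabet.symm)⟩ := by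
  rw [← initList_stk, ← haltList_stk]
  rfl

/-- A program writes `out` by pushing, hence backwards, and the transfer to the input stack of `A`
reverses it. All other registers must end empty: lifted configurations have empty extra stacks, and
so does the required halting configuration outside of the output stack. -/
theorem compose_outputs {P : Prog R} (hP : P.Ok) {inp out : R} {A : Algorithm}
    {x y z : List Letter} {t₁ t₂ : ℕ}
    (h₁ : P.Runs t₁ (update (fun _ => []) inp x) (update (fun _ => []) out y.reverse))
    (h₂ : A.OutputsInTime y z t₂) :
    (compose P inp out A).OutputsInTime x z (t₁ + (y.length + 1) + t₂) := by
  rw [Algorithm.outputsInTime_iff] at h₂ ⊢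
  obtain ⟨o, r₁⟩ := h₁.reach (composeTM P inp out A).m (fun _ => []) P Sum.inl
    (Sum.inr (Sum.inl ())) (fun _ => rfl) hP (none, A.tm.initialState) (fun _ => [])
    (fun _ _ => rfl)
  have r₂ := reach_transfer (M := (composeTM P inp out A).m) (l₀ := Sum.inr (Sum.inl ()))
    (exit := Sum.inr (Sum.inr A.tm.main)) A.inputAlphabet.symm rfl (fun _ => []) y.reverse []
    (o, A.tm.initialState)
  have r₃ := h₂.lift (M := (composeTM P inp out A).m) (L := fun l => Sum.inr (Sum.inr l))
    (fun _ => rfl)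
  have e₁ : update (fun _ => []) A.tm.k₀ [] = fun k => ([] : List (A.tm.Γ k)) :=
    update_eq_self A.tm.k₀ _
  have e₂ : Prog.contents (fun _ => []) (fun _ => []) (fun _ => [])
      = fun k => ([] : List (Prog.Alph R A.tm.Γ k)) := by
    funext k
    rcases k with ⟨_, _ | _⟩ | k <;> rfl
  rw [List.length_reverse, e₁, List.map_reverse, List.reverse_reverse, List.append_nil] at r₂
  have r := (r₁.trans r₂).trans r₃
  simp only [liftCfg] at r
  rw [← Prog.update_contents_inr, ← Prog.update_contents_reg, e₂] at r
  have hx : x.map (compose P inp out A).inputAlphabet.symm = x := List.map_id x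
  rw [hx]
  exact r

end Compose

end OrderFinding
namespace OrderFinding

/-! ### The circuit for a product of expansions -/

section Values

variable {F : Type*} [Field F] {S : Type} {n : ℕ} (val : S → F)

/-- The polynomials computed by a list of nodes that follows nodes with the values `E`. -/
noncomputable def valuesAfter (E : List (MvPolynomial (Fin n) F)) (gates : List (Gate S n)) :
    List (MvPolynomial (Fin n) F) :=
  gates.foldl (fun earlier g => earlier ++ [g.value val earlier]) E

theorem valuesAfter_append (E : List (MvPolynomial (Fin n) F)) (gs hs : List (Gate S n)) :
    valuesAfter val E (gs ++ hs) = valuesAfter val (valuesAfter val E gs) hs :=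
  List.foldl_append

/-- The values are verified instead of computed: it suffices to guess the whole list and to check
each node against the guesses before it. -/
theorem valuesAfter_eq {gs : List (Gate S n)} :
    ∀ {E Vs : List (MvPolynomial (Fin n) F)} (_ : Vs.length = gs.length),
      (∀ i (hi : i < gs.length) (hi' : i < Vs.length),
        (gs[i]).value val (E ++ Vs.take i) = Vs[i]) →
      valuesAfter val E gs = E ++ Vs := by
  induction gs with
  | nil =>
      intro E Vs hl _
      rw [List.length_nil, List.length_eq_zero_iff] at hl
      simp [hl, valuesAfter]
  | cons g gs ih =>
      intro E Vs hl h
      rcases Vs with _ | ⟨v, Vs⟩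
      · simp at hl
      · have h0 := h 0 (by simp) (by simp)
        simp only [List.take_zero, List.append_nil, List.getElem_cons_zero] at h0
        have : valuesAfter val (E ++ [v]) gs = E ++ [v] ++ Vs := by
          apply ih (by simpa using hl)
          intro i hi hi'
          have h' := h (i + 1) (Nat.succ_lt_succ hi) (Nat.succ_lt_succ hi')
          simp only [List.getElem_cons_succ, List.take_succ_cons] at h'
          rw [← List.append_cons]
          exact h'
        rw [List.append_assoc, List.singleton_append] at this
        rw [← this, valuesAfter, List.foldl_cons, h0]
        rfl

theorem gateValues_spec (gates : List (Gate S n)) :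
    ∃ hl : (gateValues val gates).length = gates.length,
      ∀ i (hi : i < gates.length), (gateValues val gates)[i]
        = (gates[i]).value val ((gateValues val gates).take i) := by
  induction gates using List.reverseRecOn with
  | nil => simp [gateValues]
  | append_singleton gs g ih =>
      obtain ⟨hl, h⟩ := ih
      have e : gateValues val (gs ++ [g])
          = gateValues val gs ++ [g.value val (gateValues val gs)] := by
        simp [gateValues]
      simp only [e]
      refine ⟨by simp [hl], fun i hi => ?_⟩
      rcases Nat.lt_or_ge i gs.length with h' | h'
      · rw [List.getElem_append_left (by omega), List.getElem_append_left h', h i h',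
          List.take_append_of_le_length (by omega)]
      · have hi' : i = gs.length := by simp at hi; omega
        subst hi'
        simp [← hl]

theorem Circuit.poly_eq_getD (C : Circuit S n) :
    C.poly val = (gateValues val C.gates).getD (C.gates.length - 1) 0 := by
  obtain ⟨hl, -⟩ := gateValues_spec val C.gates
  rw [Circuit.poly, List.getLastD_eq_getLast?, List.getLast?_eq_getElem?, hl,
    List.getD_eq_getElem?_getD]

end Values

section Tensor

variable {F : Type*} [Field F] {S : Type} {n : ℕ}

/-- The product of `k` copies of `f`, in which the variables are raised to the powers `B ^ j`. -/
noncomputable def tensorPow (B k : ℕ) (f : MvPolynomial (Fin n) F) : MvPolynomial (Fin n) F :=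
  ∏ j ∈ Finset.range k, MvPolynomial.expand (B ^ j) f

/-- A node of a copy of a circuit, which starts at the position `b`; the variables stand at the
positions from `a` on. -/
def Gate.copy (a b : ℕ) : Gate S n → Gate S n
  | .var i => .mul [a + i]
  | .const c => .const c
  | .add l => .add (l.map fun t => b + t)
  | .mul l => .mul (l.map fun t => b + t)

/-- Nodes for the powers `X i ^ B ^ j` for `j ≤ k`. -/
def powerGates (S : Type) (n B k : ℕ) : List (Gate S n) :=
  List.ofFn (fun i : Fin n => Gate.var i) ++
    (List.range (k * n)).map fun r => Gate.mul (List.replicate B r)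

/-- The first `m` copies of a list of nodes, which start at the position `b`. -/
def copyGates (gates : List (Gate S n)) (b m : ℕ) : List (Gate S n) :=
  (List.range m).flatMap fun j => gates.map (Gate.copy (j * n) (b + j * gates.length))

/-- The positions of the outputs of `k` copies of a circuit with `L` nodes that start at the
position `b`. -/
def outputPositions (b L k : ℕ) : List ℕ :=
  (List.range k).reverse.map fun j => b + (j + 1) * L - 1

/-- The nodes of a circuit for the product of the expansions. -/
def tensorGates (B k : ℕ) (gates : List (Gate S n)) : List (Gate S n) :=
  powerGates S n B k ++ copyGates gates ((k + 1) * n) k ++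
    [Gate.mul (outputPositions ((k + 1) * n) gates.length k)]

theorem length_powerGates (B k : ℕ) : (powerGates S n B k).length = (k + 1) * n := by
  simp [powerGates]; ring

theorem copyGates_succ (gates : List (Gate S n)) (b m : ℕ) :
    copyGates gates b (m + 1)
      = copyGates gates b m ++ gates.map (Gate.copy (m * n) (b + m * gates.length)) := by
  simp [copyGates, List.range_succ]

theorem length_copyGates (gates : List (Gate S n)) (b m : ℕ) :
    (copyGates gates b m).length = m * gates.length := by
  induction m with
  | zero => simp [copyGates]
  | succ m ih => rw [copyGates_succ, List.length_append, ih, List.length_map]; ring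

/-- The node at position `n + r` multiplies `B` copies of node `r`, hence raises its value to the
power `B`. Division of a position by `n` yields the variable as the remainder and the level of the
power as the quotient. -/
theorem valuesAfter_powerGates (val : S → F) (hn : 0 < n) (B k : ℕ) :
    valuesAfter val [] (powerGates S n B k) = (List.range ((k + 1) * n)).map fun r =>
      (MvPolynomial.X ⟨r % n, Nat.mod_lt r hn⟩ ^ B ^ (r / n) : MvPolynomial (Fin n) F) := by
  rw [← List.nil_append (List.map _ _)]
  apply valuesAfter_eq
  · simp [powerGates]; ring
  · intro i hi hi'
    simp only [List.length_map, List.length_range] at hi'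
    rcases Nat.lt_or_ge i n with h | h
    · simp [powerGates, h, Gate.value, Nat.div_eq_of_lt h,
        Nat.mod_eq_of_lt h]
    · obtain ⟨r, rfl⟩ := Nat.exists_eq_add_of_le h
      have hr : r < (k + 1) * n := by omega
      simp [powerGates, Gate.value, List.getElem?_take, hn, hr,
        Nat.add_div_left, pow_succ, pow_mul]

/-- As `expand c` is a ring homomorphism that fixes constants, internal nodes only need their
children shifted. A variable is redirected, through a product of fan-in one, to the node that holds
its `c`-th power. -/
theorem Gate.value_copy (val : S → F) {a b c i : ℕ}
    {E G : List (MvPolynomial (Fin n) F)} (hb : E.length = b)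
    (ha : ∀ i : Fin n, E[a + i]? = some (MvPolynomial.X i ^ c)) (hi : i ≤ G.length)
    {g : Gate S n} (hg : g.WellFormed i) :
    (g.copy a b).value val (E ++ (G.map (MvPolynomial.expand c)).take i)
      = MvPolynomial.expand c (g.value val (G.take i)) := by
  have key : ∀ t < i, (E ++ (G.map (MvPolynomial.expand c)).take i).getD (b + t) 0
      = MvPolynomial.expand c ((G.take i).getD t 0) := by
    intro t ht
    have ht' : t < G.length := by omega
    simp [← hb, ht, ht']
  cases g with
  | var j =>
      have := ha j
      have hlt : a + j < E.length := (List.getElem?_eq_some_iff.mp this).1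
      simp [Gate.copy, Gate.value, List.getElem?_append_left hlt, this]
  | const c => simp [Gate.copy, Gate.value]
  | add l =>
      simp only [Gate.copy, Gate.value, map_list_sum, List.map_map]
      congr 1
      exact List.map_congr_left fun t ht => key t (hg.2 t ht)
  | mul l =>
      simp only [Gate.copy, Gate.value, map_list_prod, List.map_map]
      congr 1
      exact List.map_congr_left fun t ht => key t (hg.2 t ht)

/-- Induction on the number of copies. A new copy is appended at the end, so the positions recorded
for the earlier outputs, each at the last node of its copy, remain valid. -/
theorem valuesAfter_copyGates (val : S → F) (C : Circuit S n) {B k b : ℕ}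
    {E : List (MvPolynomial (Fin n) F)} (hb : E.length = b)
    (hE : ∀ j ≤ k, ∀ i : Fin n, E[j * n + i]? = some (MvPolynomial.X i ^ B ^ j)) :
    ∀ m ≤ k, ∃ Vs, valuesAfter val E (copyGates C.gates b m) = E ++ Vs ∧
      Vs.length = m * C.gates.length ∧
      ∀ j < m, (E ++ Vs).getD (b + (j + 1) * C.gates.length - 1) 0
        = MvPolynomial.expand (B ^ j) (C.poly val) := by
  intro m
  induction m with
  | zero => intro _; exact ⟨[], by simp [copyGates, valuesAfter]⟩
  | succ m ih =>
      intro hm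
      obtain ⟨Vs, h₁, h₂, h₃⟩ := ih (by omega)
      obtain ⟨hl, hG⟩ := gateValues_spec val C.gates
      have hpos : 0 < C.gates.length := List.length_pos_iff.mpr C.gates_ne_nil
      refine ⟨Vs ++ (gateValues val C.gates).map (MvPolynomial.expand (B ^ m)), ?_, ?_, ?_⟩
      · rw [copyGates_succ, valuesAfter_append, h₁, ← List.append_assoc]
        apply valuesAfter_eq
        · simp [hl]
        · intro i hi hi'
          simp only [List.length_map] at hi
          rw [List.getElem_map, List.getElem_map, hG i hi]
          apply Gate.value_copy val
          · simp [h₂, hb]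
          · intro i
            have := hE m (by omega) i
            rw [List.getElem?_append_left (List.getElem?_eq_some_iff.mp this).1, this]
          · omega
          · exact C.wellFormed i hi
      · simp [h₂, hl]; ring
      · intro j hj
        rw [← List.append_assoc]
        have hlen : (E ++ Vs).length = b + m * C.gates.length := by simp [hb, h₂]
        rcases Nat.lt_succ_iff_lt_or_eq.mp hj with hj | rfl
        · rw [← h₃ j hj, List.getD_append]
          rw [hlen]
          have : (j + 1) * C.gates.length ≤ m * C.gates.length := Nat.mul_le_mul_right _ hj
          have : 0 < (j + 1) * C.gates.length := by positivity
          omega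
        · have e : b + (j + 1) * C.gates.length - 1
              = (E ++ Vs).length + (C.gates.length - 1) := by
            rw [hlen, add_mul]; omega
          rw [e, List.getD_append_right _ _ _ _ (by omega), Nat.add_sub_cancel_left,
            Circuit.poly_eq_getD, ← map_zero (MvPolynomial.expand (B ^ j)), List.getD_map, map_zero]

theorem gateValues_tensorGates (val : S → F) (C : Circuit S n) (hn : 0 < n) (B k : ℕ) :
    (gateValues val (tensorGates B k C.gates)).getLastD 0 = tensorPow B k (C.poly val) := by
  obtain ⟨Vs, h₁, h₂, h₃⟩ := valuesAfter_copyGates val C (B := B) (k := k) (b := (k + 1) * n)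
    (E := valuesAfter val [] (powerGates S n B k)) (by simp [valuesAfter_powerGates val hn])
    (by
      intro j hj i
      have h : j * n + i < (k + 1) * n := by
        have : (j + 1) * n ≤ (k + 1) * n := Nat.mul_le_mul_right _ (by omega)
        rw [add_mul] at this
        have := i.isLt
        omega
      rw [valuesAfter_powerGates val hn, List.getElem?_map, List.getElem?_range h]
      have h1 : (j * n + i) % n = i := by
        rw [Nat.add_comm, Nat.add_mul_mod_self_right, Nat.mod_eq_of_lt i.isLt]
      have h2 : (j * n + i) / n = j := by
        rw [Nat.add_comm, Nat.add_mul_div_right _ _ hn, Nat.div_eq_of_lt i.isLt, zero_add]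
      simp [h1, h2]) k le_rfl
  have h : gateValues val (tensorGates B k C.gates) = valuesAfter val
      (valuesAfter val (valuesAfter val [] (powerGates S n B k))
        (copyGates C.gates ((k + 1) * n) k))
      [Gate.mul (outputPositions ((k + 1) * n) C.gates.length k)] := by
    rw [← valuesAfter_append, ← valuesAfter_append, ← List.append_assoc]
    rfl
  rw [h, h₁]
  change (_ ++ [Gate.value val _ _]).getLastD 0 = _
  have hout := List.map_congr_left (l := (List.range k).reverse) fun j hj =>
    h₃ j (by simpa using hj)
  rw [List.getLastD_concat, Gate.value, outputPositions, List.map_map]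
  refine (congrArg List.prod hout).trans ?_
  rw [List.map_reverse, List.prod_reverse, tensorPow, ← List.prod_toFinset _ List.nodup_range,
    List.toFinset_range]

end Tensor

end OrderFinding
namespace OrderFinding

/-! ### Well-formedness of the product circuit -/

section WellFormed

variable {S : Type} {n : ℕ}

/-- The nodes are well formed if the first of them stands at the position `b`. -/
def WellFormedFrom (b : ℕ) (gates : List (Gate S n)) : Prop :=
  ∀ i (hi : i < gates.length), (gates[i]).WellFormed (b + i)

theorem WellFormedFrom.append {b c : ℕ} {gs hs : List (Gate S n)} (hg : WellFormedFrom b gs)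
    (hh : WellFormedFrom c hs) (hc : b + gs.length = c) : WellFormedFrom b (gs ++ hs) := by
  intro i hi
  rw [List.getElem_append]
  split_ifs with h
  · exact hg i h
  · have := hh (i - gs.length) (by simp at hi; omega)
    rwa [← hc, add_assoc, Nat.add_sub_cancel' (by omega)] at this

theorem wellFormedFrom_powerGates {B : ℕ} (hB : 0 < B) (hn : 0 < n) (k : ℕ) :
    WellFormedFrom 0 (powerGates S n B k) := by
  apply WellFormedFrom.append (c := n)
  · intro i hi
    simp [Gate.WellFormed]
  · intro i hi
    simp [Gate.WellFormed, hB.ne', hn]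
  · simp

theorem wellFormedFrom_copyGates (C : Circuit S n) (k b : ℕ) (hb : k * n ≤ b) :
    WellFormedFrom b (copyGates C.gates b k) := by
  suffices h : ∀ m ≤ k, WellFormedFrom b (copyGates C.gates b m) from h k le_rfl
  intro m
  induction m with
  | zero => intro _ i hi; simp [copyGates] at hi
  | succ m ih =>
      intro hm
      rw [copyGates_succ]
      refine (ih (by omega)).append (c := b + m * C.gates.length) ?_ (by rw [length_copyGates])
      intro i hi
      rw [List.getElem_map]
      have hi' : i < C.gates.length := by simpa using hi
      have hw := C.wellFormed i hi'
      generalize C.gates[i] = g at hw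
      cases g with
      | var j =>
          have h1 : (m + 1) * n ≤ k * n := Nat.mul_le_mul_right _ hm
          have := j.isLt
          simp only [Gate.copy, Gate.WellFormed, ne_eq, List.cons_ne_nil, not_false_eq_true,
            List.mem_singleton, forall_eq, true_and]
          rw [add_mul] at h1
          omega
      | const c => trivial
      | add l =>
          refine ⟨by simpa using hw.1, fun t ht => ?_⟩
          obtain ⟨u, hu, rfl⟩ := List.mem_map.mp ht
          have := hw.2 u hu
          omega
      | mul l =>
          refine ⟨by simpa using hw.1, fun t ht => ?_⟩
          obtain ⟨u, hu, rfl⟩ := List.mem_map.mp ht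
          have := hw.2 u hu
          omega

theorem wellFormedFrom_tensorGates (C : Circuit S n) (hn : 0 < n) {B k : ℕ} (hB : 0 < B)
    (hk : 0 < k) : WellFormedFrom 0 (tensorGates B k C.gates) := by
  have hL : 0 < C.gates.length := List.length_pos_iff.mpr C.gates_ne_nil
  refine ((wellFormedFrom_powerGates hB hn k).append
    (wellFormedFrom_copyGates C k ((k + 1) * n) (Nat.mul_le_mul_right _ (by omega))) ?_).append
    (c := (k + 1) * n + k * C.gates.length) ?_ ?_
  · simp [length_powerGates]
  · intro i hi
    simp only [List.getElem_singleton, Gate.WellFormed, outputPositions]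
    refine ⟨by simp [hk.ne'], fun t ht => ?_⟩
    obtain ⟨j, hj, rfl⟩ := List.mem_map.mp ht
    have hj : j < k := by simpa using hj
    have : (j + 1) * C.gates.length ≤ k * C.gates.length := Nat.mul_le_mul_right _ hj
    have : 0 < (j + 1) * C.gates.length := by positivity
    omega
  · simp [length_powerGates, length_copyGates]

/-- A circuit for the product of the expansions. -/
def Circuit.tensor (C : Circuit S n) (hn : 0 < n) {B k : ℕ} (hB : 0 < B) (hk : 0 < k) :
    Circuit S n where
  gates := tensorGates B k C.gates
  gates_ne_nil := by simp [tensorGates]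
  wellFormed := by simpa [WellFormedFrom] using wellFormedFrom_tensorGates C hn hB hk

end WellFormed

/-! ### Degree bound and encoding of the new instance -/

section Encoding

variable {S : Set (List Bool)}

/-- The input for the product of `k` expansions. -/
def Instance.tensor (I : Instance S) (hn : 0 < I.n) {k : ℕ} (hk : 0 < k) : Instance S where
  n := I.n
  d := (I.d + 1) ^ k
  C := I.C.tensor hn I.d.succ_pos hk

/-- Copy `j` contributes at most `(d + 1)^j * d`, and the geometric sum of these is `(d + 1)^k - 1`.
-/
theorem degreeOf_tensorPow_le {F : Type*} [Field F] {n : ℕ} {f : MvPolynomial (Fin n) F}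
    {i : Fin n} {d : ℕ} (h : f.degreeOf i ≤ d) (k : ℕ) :
    (tensorPow (d + 1) k f).degreeOf i ≤ (d + 1) ^ k := by
  have h₁ : ∀ c, (MvPolynomial.expand c f).degreeOf i ≤ c * d := by
    intro c
    rw [MvPolynomial.degreeOf_le_iff]
    intro m hm
    have := MvPolynomial.support_expand_subset (p := c) f hm
    obtain ⟨m', hm', rfl⟩ := Finset.mem_image.mp this
    exact Nat.mul_le_mul_left _ ((MvPolynomial.degreeOf_le_iff.mp h) m' hm')
  have h₂ : ∑ j ∈ Finset.range k, (d + 1) ^ j * d ≤ (d + 1) ^ k := by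
    have := geom_sum_mul_add d k
    rw [← Finset.sum_mul]
    omega
  exact (MvPolynomial.degreeOf_prod_le _ _ _).trans
    ((Finset.sum_le_sum fun j _ => h₁ _).trans h₂)

theorem Instance.poly_tensor {F : Type*} [Field F] (val : S → F) (I : Instance S) (hn : 0 < I.n)
    {k : ℕ} (hk : 0 < k) :
    (I.tensor hn hk).C.poly val = tensorPow (I.d + 1) k (I.C.poly val) :=
  gateValues_tensorGates val I.C hn (I.d + 1) k

theorem Instance.Valid.tensor {F : Type*} [Field F] {val : S → F} {I : Instance S}
    (h : I.Valid val) {k : ℕ} (hk : 0 < k) : (I.tensor h.1 hk).Valid val :=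
  ⟨h.1, fun i => by
    rw [Instance.poly_tensor]
    exact degreeOf_tensorPow_le (h.2 i) k⟩

/-- What becomes of a letter in the encoding of a copy of a circuit. -/
def Letter.copy (a b : ℕ) : Letter → List Letter
  | .varTag => .mulTag :: .item :: encodeUnary a
  | .item => .item :: encodeUnary b
  | x => [x]

theorem flatMap_copy_encodeUnary (a b i : ℕ) :
    (encodeUnary i).flatMap (Letter.copy a b) = encodeUnary i := by
  induction i with
  | zero => rfl
  | succ i ih =>
      rw [encodeUnary, List.replicate_succ, List.flatMap_cons, ← encodeUnary, ih]
      rfl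

theorem flatMap_copy_encodeList (a b : ℕ) (l : List ℕ) :
    (encodeList l).flatMap (Letter.copy a b) = encodeList (l.map fun t => b + t) := by
  induction l with
  | nil => rfl
  | cons t l ih =>
      simp only [encodeList, List.flatMap_cons, List.flatMap_append, List.map_cons] at ih ⊢
      rw [ih, flatMap_copy_encodeUnary]
      simp [Letter.copy, encodeUnary]

/-- Numbers are in unary, so a shift inserts tallies right after a separator, and a variable tag
becomes the head of a product with one child. Hence a circuit can be copied in a single pass over
its letters, without parsing the nodes. -/
theorem encode_copy {n : ℕ} (a b : ℕ) (g : Gate S n) :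
    (g.copy a b).encode = g.encode.flatMap (Letter.copy a b) := by
  cases g with
  | var i =>
      simp only [Gate.copy, Gate.encode, List.flatMap_cons, flatMap_copy_encodeUnary]
      simp [Letter.copy, encodeList, encodeUnary]
  | const c =>
      simp only [Gate.copy, Gate.encode, List.flatMap_cons, List.flatMap_map, Letter.copy]
      rw [List.map_eq_flatMap]
      rfl
  | add l =>
      simp only [Gate.copy, Gate.encode, List.flatMap_cons, flatMap_copy_encodeList]
      rfl
  | mul l =>
      simp only [Gate.copy, Gate.encode, List.flatMap_cons, flatMap_copy_encodeList]
      rfl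

/-- The encoding of the input for the product of `k` expansions, in terms of the encoding `g` of
the nodes of the original circuit, of which there are `L`. -/
def tensorEncoding (g : List Letter) (n d L k : ℕ) : List Letter :=
  (List.range n).flatMap (fun i => .varTag :: encodeUnary i) ++
  (List.range (k * n)).flatMap (fun r => .mulTag :: encodeList (List.replicate (d + 1) r)) ++
  (List.range k).flatMap (fun j => g.flatMap (Letter.copy (j * n) ((k + 1) * n + j * L))) ++
  .mulTag :: encodeList (outputPositions ((k + 1) * n) L k) ++
  [.endMark] ++ encodeUnary n ++ [.endMark] ++ encodeUnary ((d + 1) ^ k) ++ [.endMark]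

theorem Instance.encode_tensor (I : Instance S) (hn : 0 < I.n) {k : ℕ} (hk : 0 < k) :
    (I.tensor hn hk).encode
      = tensorEncoding (I.C.gates.flatMap Gate.encode) I.n I.d I.C.gates.length k := by
  have h₁ : (List.ofFn fun i : Fin I.n => (Gate.var i : Gate S I.n)).flatMap Gate.encode
      = (List.range I.n).flatMap (fun i => .varTag :: encodeUnary i) := by
    rw [List.ofFn_eq_map, ← List.map_coe_finRange_eq_range, List.flatMap_map, List.flatMap_map]
    rfl
  have h₂ : ∀ b m, (copyGates I.C.gates b m).flatMap Gate.encode = (List.range m).flatMap fun j =>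
      (I.C.gates.flatMap Gate.encode).flatMap
        (Letter.copy (j * I.n) (b + j * I.C.gates.length)) := by
    intro b m
    rw [copyGates, List.flatMap_assoc]
    congr 1
    funext j
    rw [List.flatMap_map, List.flatMap_assoc]
    congr 1
    funext g
    exact encode_copy _ _ g
  simp only [Instance.encode, Instance.tensor, Circuit.tensor, tensorGates, powerGates,
    List.flatMap_append, h₁, h₂, List.flatMap_map, tensorEncoding]
  simp [Gate.encode]

end Encoding

end OrderFinding
namespace OrderFinding

open Module Submodule

/-! ### Coefficient matrices of polynomials -/

section Cut

variable {F : Type*} [Field F] {n : ℕ}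

/-- The coefficient of a monomial that is given by a function. -/
noncomputable def coef (f : MvPolynomial (Fin n) F) (w : Fin n → ℕ) : F :=
  f.coeff (Finsupp.equivFunOnFinite.symm w)

/-- The coefficient matrix of `f` for the variables in `S` against the other ones. Only the values
on `S` of the row index and the values outside of `S` of the column index matter. -/
noncomputable def cut (f : MvPolynomial (Fin n) F) (S : Finset (Fin n)) (u v : Fin n → ℕ) : F :=
  coef f (S.piecewise u v)

/-- The row space of the coefficient matrix. -/
noncomputable def rowSpace (f : MvPolynomial (Fin n) F) (S : Finset (Fin n)) :
    Submodule F ((Fin n → ℕ) → F) :=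
  span F (Set.range (cut f S))

theorem coef_eq_zero {f : MvPolynomial (Fin n) F} {i : Fin n} {d : ℕ} (h : f.degreeOf i ≤ d)
    {w : Fin n → ℕ} (hw : d < w i) : coef f w = 0 := by
  by_contra hne
  have := MvPolynomial.degreeOf_le_iff.mp h _ (MvPolynomial.mem_support_iff.mpr hne)
  exact absurd hw (not_lt.mpr this)

theorem cut_congr (f : MvPolynomial (Fin n) F) {S : Finset (Fin n)} {u u' v v' : Fin n → ℕ}
    (hu : ∀ i ∈ S, u i = u' i) (hv : ∀ i ∉ S, v i = v' i) : cut f S u v = cut f S u' v' := by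
  unfold cut
  congr 1
  funext i
  by_cases h : i ∈ S
  · simp [h, hu i h]
  · simp [h, hv i h]

/-- Nonzero rows can be indexed by exponent vectors of `f`. This leaves finitely many rows, and
indices whose entries are bounded by the individual degree. -/
theorem cut_eq_zero_or_exists (f : MvPolynomial (Fin n) F) (S : Finset (Fin n))
    (u : Fin n → ℕ) : cut f S u = 0 ∨ ∃ m : Fin n → ℕ, coef f m ≠ 0 ∧ cut f S u = cut f S m := by
  by_cases h : ∀ v, cut f S u v = 0
  · exact Or.inl (funext h)
  · push Not at h
    obtain ⟨v, hv⟩ := h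
    exact Or.inr ⟨S.piecewise u v, hv, funext fun v' =>
      cut_congr f (fun i hi => by simp [hi]) fun _ _ => rfl⟩

theorem cut_apply_eq_zero_or_exists (f : MvPolynomial (Fin n) F) (S : Finset (Fin n))
    (v : Fin n → ℕ) : (∀ u, cut f S u v = 0) ∨
      ∃ m : Fin n → ℕ, coef f m ≠ 0 ∧ ∀ u, cut f S u v = cut f S u m := by
  by_cases h : ∀ u, cut f S u v = 0
  · exact Or.inl h
  · push Not at h
    obtain ⟨u, hu⟩ := h
    exact Or.inr ⟨S.piecewise u v, hu, fun u' =>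
      cut_congr f (fun _ _ => rfl) fun i hi => by simp [hi]⟩

instance finiteDimensional_rowSpace (f : MvPolynomial (Fin n) F) (S : Finset (Fin n)) :
    FiniteDimensional F (rowSpace f S) := by
  apply FiniteDimensional.span_of_finite
  apply ((f.support.finite_toSet.image fun m : Fin n →₀ ℕ => cut f S m).insert 0).subset
  rintro _ ⟨u, rfl⟩
  rcases cut_eq_zero_or_exists f S u with h | ⟨m, hm, h⟩
  · exact Or.inl h
  · exact Or.inr ⟨Finsupp.equivFunOnFinite.symm m, MvPolynomial.mem_support_iff.mpr hm, h.symm⟩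

/-- The counterpart for columns: both alternatives are linear conditions on `φ`, so they pass from
the rows to their span. -/
theorem rowSpace_apply_eq_zero_or_exists (f : MvPolynomial (Fin n) F) (S : Finset (Fin n))
    (v : Fin n → ℕ) : (∀ φ ∈ rowSpace f S, φ v = 0) ∨
      ∃ m : Fin n → ℕ, coef f m ≠ 0 ∧ ∀ φ ∈ rowSpace f S, φ v = φ m := by
  rcases cut_apply_eq_zero_or_exists f S v with h | ⟨m, hm, h⟩
  · left
    intro φ hφ
    have : rowSpace f S ≤ LinearMap.ker (LinearMap.proj v : ((Fin n → ℕ) → F) →ₗ[F] F) := by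
      rw [rowSpace, span_le]
      rintro _ ⟨u, rfl⟩
      exact h u
    exact this hφ
  · refine Or.inr ⟨m, hm, fun φ hφ => ?_⟩
    have : rowSpace f S ≤ LinearMap.ker
        ((LinearMap.proj v : ((Fin n → ℕ) → F) →ₗ[F] F) - LinearMap.proj m) := by
      rw [rowSpace, span_le]
      rintro _ ⟨u, rfl⟩
      simp [h u]
    have := this hφ
    simpa [sub_eq_zero] using this

/-- The tensor product of two functions, by means of division with remainder. -/
def tensorFun (F : Type*) [Field F] (n B : ℕ) :
    ((Fin n → ℕ) → F) →ₗ[F] ((Fin n → ℕ) → F) →ₗ[F] ((Fin n → ℕ) → F) :=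
  LinearMap.mk₂ F (fun φ ψ v => φ (fun i => v i % B) * ψ (fun i => v i / B))
    (fun _ _ _ => funext fun _ => add_mul _ _ _) (fun _ _ _ => funext fun _ => mul_assoc _ _ _)
    (fun _ _ _ => funext fun _ => mul_add _ _ _)
    (fun _ _ _ => funext fun _ => mul_left_comm _ _ _)

@[simp] theorem tensorFun_apply (B : ℕ) (φ ψ : (Fin n → ℕ) → F) (v : Fin n → ℕ) :
    tensorFun F n B φ ψ v = φ (fun i => v i % B) * ψ (fun i => v i / B) := rfl

/-- Exponents of `f` are at most `d` and those of the expansion are multiples of `d + 1`, so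
uniqueness of division with remainder leaves one term of the convolution. -/
theorem coef_mul_expand {f g : MvPolynomial (Fin n) F} {d : ℕ} (hf : ∀ i, f.degreeOf i ≤ d)
    (w : Fin n → ℕ) : coef (f * MvPolynomial.expand (d + 1) g) w
      = coef f (fun i => w i % (d + 1)) * coef g (fun i => w i / (d + 1)) := by
  classical
  unfold coef
  rw [MvPolynomial.coeff_mul, Finset.sum_eq_single
    (Finsupp.equivFunOnFinite.symm fun i => w i % (d + 1),
      (d + 1) • Finsupp.equivFunOnFinite.symm fun i => w i / (d + 1))]
  · rw [MvPolynomial.coeff_expand_smul _ d.succ_ne_zero]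
  · rintro ⟨x, y⟩ hxy hne
    rw [Finset.HasAntidiagonal.mem_antidiagonal] at hxy
    by_contra h0
    have hx : ∀ i, x i < d + 1 := fun i => Nat.lt_succ_of_le
      (MvPolynomial.degreeOf_le_iff.mp (hf i) x
        (MvPolynomial.mem_support_iff.mpr (left_ne_zero_of_mul h0)))
    have hy : ∀ i, d + 1 ∣ y i := fun i => by
      by_contra h
      exact right_ne_zero_of_mul h0 (MvPolynomial.coeff_expand_of_not_dvd _ h)
    have hw : ∀ i, x i + y i = w i := fun i => by simpa using DFunLike.congr_fun hxy i
    apply hne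
    rw [Prod.mk.injEq]
    constructor
    · ext i
      obtain ⟨c, hc⟩ := hy i
      simp [← hw i, hc, Nat.mod_eq_of_lt (hx i)]
    · ext i
      obtain ⟨c, hc⟩ := hy i
      simp [← hw i, hc, Nat.add_mul_div_left, Nat.div_eq_of_lt (hx i)]
  · intro h
    exfalso
    apply h
    rw [Finset.HasAntidiagonal.mem_antidiagonal]
    ext i
    simp [Nat.mod_add_div]

theorem cut_mul_expand {f g : MvPolynomial (Fin n) F} {d : ℕ} (hf : ∀ i, f.degreeOf i ≤ d)
    (S : Finset (Fin n)) (u : Fin n → ℕ) : cut (f * MvPolynomial.expand (d + 1) g) S u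
      = tensorFun F n (d + 1) (cut f S fun i => u i % (d + 1))
        (cut g S fun i => u i / (d + 1)) := by
  funext v
  rw [cut, coef_mul_expand hf, tensorFun_apply, cut, cut]
  congr 2 <;> funext i <;> by_cases h : i ∈ S <;> simp [h]

/-- Splitting indices into remainders and quotients exhibits the matrix of the product as a
Kronecker product, so the products of basis vectors form a basis of its row space. Only the first
factor needs the degree bound. -/
theorem finrank_rowSpace_mul_expand {f g : MvPolynomial (Fin n) F} {d : ℕ}
    (hf : ∀ i, f.degreeOf i ≤ d) (S : Finset (Fin n)) :
    finrank F (rowSpace (f * MvPolynomial.expand (d + 1) g) S)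
      = finrank F (rowSpace f S) * finrank F (rowSpace g S) := by
  set b := finBasis F (rowSpace f S)
  set c := finBasis F (rowSpace g S)
  set T := tensorFun F n (d + 1)
  have hlt : ∀ m : Fin n → ℕ, coef f m ≠ 0 → ∀ i, m i < d + 1 := fun m hm i => by
    by_contra h
    exact hm (coef_eq_zero (hf i) (by omega))
  have hb : span F (Set.range fun i => (b i : (Fin n → ℕ) → F)) = rowSpace f S := by
    have := congrArg (Submodule.map (rowSpace f S).subtype) b.span_eq
    rwa [map_span, ← Set.range_comp, map_subtype_top] at this
  have hc : span F (Set.range fun i => (c i : (Fin n → ℕ) → F)) = rowSpace g S := by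
    have := congrArg (Submodule.map (rowSpace g S).subtype) c.span_eq
    rwa [map_span, ← Set.range_comp, map_subtype_top] at this
  have hdiv : ∀ (m v : Fin n → ℕ), (∀ i, m i < d + 1) →
      (fun i => (m i + (d + 1) * v i) % (d + 1)) = m ∧
      (fun i => (m i + (d + 1) * v i) / (d + 1)) = v := fun m v hm =>
    ⟨funext fun i => by simp [Nat.mod_eq_of_lt (hm i)],
      funext fun i => by
        rw [Nat.add_mul_div_left _ _ d.succ_pos, Nat.div_eq_of_lt (hm i), zero_add]⟩
  have hspan : rowSpace (f * MvPolynomial.expand (d + 1) g) S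
      = span F (Set.range fun p : Fin _ × Fin _ => T (b p.1) (c p.2)) := by
    have h₁ : span F (Set.range fun p : Fin _ × Fin _ => T (b p.1) (c p.2))
        = map₂ T (rowSpace f S) (rowSpace g S) := by
      have := map₂_span_span F T (Set.range fun i => (b i : (Fin n → ℕ) → F))
        (Set.range fun i => (c i : (Fin n → ℕ) → F))
      rw [hb, hc, Set.image2_range] at this
      exact this.symm
    rw [h₁]
    apply le_antisymm
    · rw [rowSpace, span_le]
      rintro _ ⟨u, rfl⟩
      rw [cut_mul_expand hf]
      exact apply_mem_map₂ _ (subset_span ⟨_, rfl⟩) (subset_span ⟨_, rfl⟩)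
    -- Conversely, a nonzero row of `f` has an index `m` with entries below `d + 1`, so its product
    -- with row `u'` of `g` is the row with index `m + (d + 1) * u'`.
    · rw [rowSpace, rowSpace, map₂_span_span, span_le]
      rintro _ ⟨_, ⟨u, rfl⟩, _, ⟨u', rfl⟩, rfl⟩
      rcases cut_eq_zero_or_exists f S u with h | ⟨m, hm, h⟩
      · rw [h]
        change T 0 _ ∈ _
        rw [LinearMap.map_zero₂]
        exact zero_mem _
      · rw [h]
        refine subset_span ⟨fun i => m i + (d + 1) * u' i, ?_⟩
        obtain ⟨h₁, h₂⟩ := hdiv m u' (hlt m hm)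
        rw [cut_mul_expand hf, h₁, h₂]
  have hli : LinearIndependent F fun p : Fin _ × Fin _ => T (b p.1) (c p.2) := by
    rw [Fintype.linearIndependent_iff]
    intro a ha
    -- The relation separates into independent arguments `v` and `v'`: a column `v` that is not zero
    -- on the row space may be replaced by an exponent vector `m` of `f`, and then `m` and `v'` are
    -- the digits of one index.
    have h₁ : ∀ v v', ∑ i, ∑ j, a (i, j) * ((b i : (Fin n → ℕ) → F) v *
        (c j : (Fin n → ℕ) → F) v') = 0 := by
      intro v v'
      rcases rowSpace_apply_eq_zero_or_exists f S v with h | ⟨m, hm, h⟩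
      · simp [h _ (b _).2]
      · have := congrFun ha fun i => m i + (d + 1) * v' i
        obtain ⟨h₁, h₂⟩ := hdiv m v' (hlt m hm)
        simp only [Fintype.sum_prod_type, Finset.sum_apply, Pi.smul_apply, smul_eq_mul,
          Pi.zero_apply, T, tensorFun_apply, h₁, h₂] at this
        simpa only [h _ (b _).2] using this
    have hb' := b.linearIndependent.map' (rowSpace f S).subtype (ker_subtype _)
    have hc' := c.linearIndependent.map' (rowSpace g S).subtype (ker_subtype _)
    rw [Fintype.linearIndependent_iff] at hb' hc'
    rintro ⟨i, j⟩
    -- For fixed `v`, independence of `c` annihilates each `∑ i, a (i, j) * b i v`; letting `v`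
    -- vary, independence of `b` annihilates `a`.
    refine hb' (fun i => a (i, j)) (funext fun v => ?_) i
    have := hc' (fun j => ∑ i, a (i, j) * (b i : (Fin n → ℕ) → F) v) (funext fun v' => ?_) j
    · simpa [Finset.sum_apply] using this
    · have := h₁ v v'
      rw [Finset.sum_comm] at this
      simpa [Finset.sum_apply, Finset.sum_mul, mul_assoc] using this
  rw [hspan, finrank_span_eq_card hli]
  simp

/-- The factor split off is the one without expansion: it obeys the degree bound `d`, and the rest,
of large degree, may serve as the unrestricted second factor of `finrank_rowSpace_mul_expand`. -/
theorem tensorPow_succ (B k : ℕ) (f : MvPolynomial (Fin n) F) :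
    tensorPow B (k + 1) f = f * MvPolynomial.expand B (tensorPow B k f) := by
  rw [tensorPow, Finset.prod_range_succ', mul_comm, pow_zero, MvPolynomial.expand_one_apply,
    tensorPow, map_prod]
  congr 1
  refine Finset.prod_congr rfl fun j _ => ?_
  rw [pow_succ', MvPolynomial.expand_mul]

theorem finrank_rowSpace_tensorPow {f : MvPolynomial (Fin n) F} {d : ℕ}
    (hf : ∀ i, f.degreeOf i ≤ d) (S : Finset (Fin n)) (k : ℕ) :
    finrank F (rowSpace (tensorPow (d + 1) (k + 1) f) S) = finrank F (rowSpace f S) ^ (k + 1) := by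
  induction k with
  | zero =>
      have : tensorPow (d + 1) (0 + 1) f = f := by
        rw [tensorPow, zero_add, Finset.prod_range_one, pow_zero, MvPolynomial.expand_one_apply]
      rw [this, zero_add, pow_one]
  | succ k ih => rw [tensorPow_succ, finrank_rowSpace_mul_expand hf, ih, pow_succ' _ (k + 1)]

end Cut

end OrderFinding
namespace OrderFinding

open Module Submodule

/-! ### The width of an ROABP in a given order -/

section Nisan

variable {F : Type*} [Field F]

/-- The sum over paths as a product of transfer matrices. The start vector `φ` is arbitrary for the
sake of the induction: the weights out of the first vertex become the start vector of the remaining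
layers. -/
theorem sum_paths_eq : ∀ {n : ℕ} (l : Fin (n + 1) → ℕ)
    (M : (i : Fin n) → Fin (l i.castSucc) → Fin (l i.succ) → F) (φ : Fin (l 0) → F)
    (suf : (i : Fin (n + 1)) → Fin (l i) → F)
    (_ : ∀ i a, suf (Fin.castSucc i) a = ∑ c, M i a c * suf i.succ c),
    ∑ path : ((i : Fin (n + 1)) → Fin (l i)), φ (path 0) *
        ((∏ i : Fin n, M i (path i.castSucc) (path i.succ)) * suf (Fin.last n) (path (Fin.last n)))
      = ∑ a, φ a * suf 0 a := by
  intro n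
  induction n with
  | zero =>
      intro l M φ suf _
      let : Unique (Fin (0 + 1)) := inferInstanceAs (Unique (Fin 1))
      refine Fintype.sum_equiv (Equiv.piUnique fun i : Fin (0 + 1) => Fin (l i)) _
        (fun a : Fin (l 0) => φ a * suf 0 a) fun path => ?_
      simp only [Finset.univ_eq_empty, Finset.prod_empty, one_mul]
      rfl
  | succ n ih =>
      intro l M φ suf hsuf
      rw [← Fintype.sum_equiv (Fin.consEquiv fun i => Fin (l i)) _ _ fun _ => rfl,
        Fintype.sum_prod_type]
      refine Finset.sum_congr rfl fun a _ => ?_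
      rw [show suf 0 a = _ from hsuf 0 a,
        ← ih (fun i => l i.succ) (fun i => M i.succ) (M 0 a) (fun i => suf i.succ)
          fun i a => hsuf i.succ a, Finset.mul_sum]
      refine Finset.sum_congr rfl fun path _ => ?_
      rw [Fin.prod_univ_succ, mul_assoc]
      rfl

/-- Since `σ` is a bijection, each variable occurs in exactly one factor, and only one choice of
monomials contributes. -/
theorem coef_prod_aeval {n : ℕ} (σ : Equiv.Perm (Fin n)) (p : Fin n → Polynomial F)
    (w : Fin n → ℕ) :
    coef (∏ i, Polynomial.aeval (MvPolynomial.X (σ i) : MvPolynomial (Fin n) F) (p i)) w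
      = ∏ i, (p i).coeff (w (σ i)) := by
  classical
  set N := (Finset.univ.sup fun i => (p i).natDegree) + (Finset.univ.sup w) + 1 with hN
  have h₁ : ∀ i, (p i).natDegree < N := fun i => by
    have := Finset.le_sup (f := fun i => (p i).natDegree) (Finset.mem_univ i)
    omega
  have h₂ : ∀ i, w i < N := fun i => by
    have := Finset.le_sup (f := w) (Finset.mem_univ i)
    omega
  have h₃ : ∀ φ : Fin n → ℕ, ∏ i, ((p i).coeff (φ i) •
      (MvPolynomial.X (σ i) : MvPolynomial (Fin n) F) ^ φ i)
      = MvPolynomial.monomial (Finsupp.equivFunOnFinite.symm fun i => φ (σ.symm i))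
        (∏ i, (p i).coeff (φ i)) := by
    intro φ
    rw [Finset.prod_smul, MvPolynomial.monomial_eq, MvPolynomial.smul_eq_C_mul,
      Finsupp.prod_fintype _ _ (by simp)]
    congr 1
    exact Fintype.prod_equiv σ _ _ fun i => by simp
  simp only [Polynomial.aeval_eq_sum_range' (h₁ _)]
  rw [Finset.prod_univ_sum, coef, MvPolynomial.coeff_sum,
    Finset.sum_eq_single fun i => w (σ i)]
  · rw [h₃, MvPolynomial.coeff_monomial, if_pos (by ext i; simp)]
  · intro φ _ hφ
    rw [h₃, MvPolynomial.coeff_monomial, if_neg]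
    intro h
    apply hφ
    funext i
    have := DFunLike.congr_fun h (σ i)
    simpa using this
  · intro h
    exact absurd (Fintype.mem_piFinset.mpr fun i => Finset.mem_range.mpr (h₂ (σ i))) h

variable {n : ℕ}

/-- The variables that are read in the first `i` steps. -/
def readBefore (σ : Equiv.Perm (Fin n)) (i : Fin (n + 1)) : Finset (Fin n) :=
  Finset.univ.filter fun x => (σ.symm x).castSucc < i

@[simp] theorem mem_readBefore {σ : Equiv.Perm (Fin n)} {i : Fin (n + 1)} {x : Fin n} :
    x ∈ readBefore σ i ↔ (σ.symm x).castSucc < i := by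
  simp [readBefore]

theorem ROABP.coef_poly {d : ℕ} (R : ROABP F n d) (σ : Equiv.Perm (Fin n)) (w : Fin n → ℕ)
    (suf : (i : Fin (n + 1)) → Fin (R.layerSize i) → F)
    (h : ∀ i a, suf (Fin.castSucc i) a = ∑ c, (R.weight i a c).coeff (w (σ i)) * suf i.succ c)
    (hlast : ∀ a, suf (Fin.last n) a = 1) : coef (R.poly σ) w = ∑ a, suf 0 a := by
  have := sum_paths_eq R.layerSize (fun i a c => (R.weight i a c).coeff (w (σ i)))
    (fun _ => 1) suf h
  simp only [one_mul, hlast, mul_one] at this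
  rw [← this, ROABP.poly, coef, MvPolynomial.coeff_sum]
  exact Finset.sum_congr rfl fun path _ => coef_prod_aeval σ _ w

/-- All paths are cut at layer `i`. The initial segments (`pre`) see only the variables read before
the cut and the final segments (`suf`) only the others, so the coefficient matrix factors through
the vertices of that layer. -/
theorem ROABP.exists_factorization {d : ℕ} (R : ROABP F n d) (σ : Equiv.Perm (Fin n))
    (i : Fin (n + 1)) : ∃ A B : Fin (R.layerSize i) → (Fin n → ℕ) → F,
      ∀ u v, cut (R.poly σ) (readBefore σ i) u v = ∑ a, A a u * B a v := by
  let pre : (w : Fin n → ℕ) → (i : Fin (n + 1)) → Fin (R.layerSize i) → F := fun w i =>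
    Fin.induction (motive := fun i => Fin (R.layerSize i) → F) (fun _ => 1)
      (fun i p c => ∑ a, p a * (R.weight i a c).coeff (w (σ i))) i
  let suf : (w : Fin n → ℕ) → (i : Fin (n + 1)) → Fin (R.layerSize i) → F := fun w i =>
    Fin.reverseInduction (motive := fun i => Fin (R.layerSize i) → F) (fun _ => 1)
      (fun i s a => ∑ c, (R.weight i a c).coeff (w (σ i)) * s c) i
  have pre_succ : ∀ w i c, pre w i.succ c
      = ∑ a, pre w i.castSucc a * (R.weight i a c).coeff (w (σ i)) := fun w i c => by
    simp only [pre, Fin.induction_succ]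
  have suf_last : ∀ w a, suf w (Fin.last n) a = 1 := fun w a => by
    simp only [suf, Fin.reverseInduction_last]
  have suf_castSucc : ∀ w i a, suf w (Fin.castSucc i) a
      = ∑ c, (R.weight i a c).coeff (w (σ i)) * suf w i.succ c := fun w i a => by
    simp only [suf, Fin.reverseInduction_castSucc]
  have hsum : ∀ w (i : Fin (n + 1)), coef (R.poly σ) w = ∑ a, pre w i a * suf w i a := by
    intro w i
    induction i using Fin.induction with
    | zero =>
        rw [R.coef_poly σ w (suf w) (suf_castSucc w) (suf_last w)]
        exact Finset.sum_congr rfl fun a _ => by simp [pre]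
    | succ i ih =>
        rw [ih]
        simp only [suf_castSucc, pre_succ, Finset.mul_sum, Finset.sum_mul]
        rw [Finset.sum_comm]
        simp only [mul_assoc]
  have hpre : ∀ w w' (i : Fin (n + 1)), (∀ j : Fin n, j.castSucc < i → w (σ j) = w' (σ j)) →
      pre w i = pre w' i := by
    intro w w' i
    induction i using Fin.induction with
    | zero => intro _; simp [pre]
    | succ i ih =>
        intro h
        funext c
        rw [pre_succ, pre_succ, ih fun j hj => h j (hj.trans i.castSucc_lt_succ),
          h i i.castSucc_lt_succ]
  have hsuf : ∀ w w' (i : Fin (n + 1)), (∀ j : Fin n, ¬ j.castSucc < i → w (σ j) = w' (σ j)) →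
      suf w i = suf w' i := by
    intro w w' i
    induction i using Fin.reverseInduction with
    | last => intro _; funext a; rw [suf_last, suf_last]
    | cast i ih =>
        intro h
        funext a
        rw [suf_castSucc, suf_castSucc,
          ih fun j hj => h j fun hj' => hj (hj'.trans i.castSucc_lt_succ), h i (lt_irrefl _)]
  refine ⟨fun a u => pre u i a, fun a v => suf v i a, fun u v => ?_⟩
  rw [cut, hsum _ i]
  refine Finset.sum_congr rfl fun a _ => ?_
  rw [hpre _ u i fun j hj => by simp [Finset.piecewise, hj],
    hsuf _ v i fun j hj => by simp [Finset.piecewise, hj]]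

/-- The lower bound in Nisan's characterisation: every row is a combination of as many functions as
the layer has vertices. -/
theorem HasROABP.finrank_le {d : ℕ} {f : MvPolynomial (Fin n) F} {σ : Equiv.Perm (Fin n)} {w : ℕ}
    (h : HasROABP d f σ w) (i : Fin (n + 1)) :
    finrank F (rowSpace f (readBefore σ i)) ≤ w := by
  obtain ⟨R, rfl, rfl⟩ := h
  obtain ⟨A, B, hAB⟩ := R.exists_factorization σ i
  have hle : rowSpace (R.poly σ) (readBefore σ i) ≤ span F (Set.range B) := by
    rw [rowSpace, span_le]
    rintro _ ⟨u, rfl⟩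
    have : cut (R.poly σ) (readBefore σ i) u = ∑ a, A a u • B a := by
      funext v
      rw [hAB]
      simp [Finset.sum_apply]
    rw [this]
    exact sum_mem fun a _ => smul_mem _ _ (subset_span ⟨a, rfl⟩)
  have : FiniteDimensional F (span F (Set.range B)) :=
    FiniteDimensional.span_of_finite F (Set.finite_range B)
  calc finrank F (rowSpace (R.poly σ) (readBefore σ i))
      ≤ finrank F (span F (Set.range B)) := Submodule.finrank_mono hle
    _ ≤ R.layerSize i := (finrank_range_le_card (R := F) B).trans (Fintype.card_fin _).le
    _ ≤ R.width := Finset.le_sup (f := R.layerSize) (Finset.mem_univ i)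

theorem HasROABP.one_le {d : ℕ} {f : MvPolynomial (Fin n) F} {σ : Equiv.Perm (Fin n)} {w : ℕ}
    (h : HasROABP d f σ w) : 1 ≤ w := by
  obtain ⟨R, -, rfl⟩ := h
  rw [← R.source]
  exact Finset.le_sup (f := R.layerSize) (Finset.mem_univ 0)

/-- Fixing the exponent of the next variable moves this entry from the column index to the row
index, which turns rows at one cut into rows at the next. -/
theorem restrict_mem_rowSpace (f : MvPolynomial (Fin n) F) (σ : Equiv.Perm (Fin n)) (i : Fin n)
    (e : ℕ) {φ : (Fin n → ℕ) → F} (hφ : φ ∈ rowSpace f (readBefore σ i.castSucc)) :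
    (fun v => φ (Function.update v (σ i) e)) ∈ rowSpace f (readBefore σ i.succ) := by
  have : rowSpace f (readBefore σ i.castSucc) ≤ (rowSpace f (readBefore σ i.succ)).comap
      (LinearMap.funLeft F F fun v : Fin n → ℕ => Function.update v (σ i) e) := by
    rw [rowSpace, span_le]
    rintro _ ⟨u, rfl⟩
    refine subset_span ⟨Function.update u (σ i) e, ?_⟩
    funext v
    change coef f _ = coef f _
    congr 1
    funext x
    rcases eq_or_ne x (σ i) with rfl | hx
    · simp [Finset.piecewise]
    · have hx' : σ.symm x ≠ i := fun h => hx (by rw [← h, Equiv.apply_symm_apply])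
      have : (σ.symm x).castSucc < i.succ ↔ (σ.symm x).castSucc < i.castSucc := by
        rw [Fin.castSucc_lt_succ_iff, Fin.castSucc_lt_castSucc_iff, lt_iff_le_and_ne]
        simp [hx']
      simp [Finset.piecewise, this, hx]
  exact this hφ

/-- The upper bound in Nisan's characterisation. The vertices of an inner layer are a basis of the
row space at that cut. The coefficient of degree `e` of a label is a coordinate, in the next layer,
of a basis function with the next exponent fixed to `e`. The sum over the paths from a vertex to the
sink then has the function at this vertex as its coefficients. -/
theorem exists_hasROABP (hn : 0 < n) {d W : ℕ} {f : MvPolynomial (Fin n) F}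
    (hf : ∀ i, f.degreeOf i ≤ d) (σ : Equiv.Perm (Fin n)) (hW : 1 ≤ W)
    (h : ∀ i, finrank F (rowSpace f (readBefore σ i)) ≤ W) : ∃ w ≤ W, HasROABP d f σ w := by
  -- The two end layers need exactly one vertex each, whatever the rank: `coef f` at the source and
  -- the constant function 1 at the sink. For `f = 0` the latter is not in the row space, so
  -- membership is claimed only before the last layer.
  have hbase : ∀ i : Fin (n + 1), ∃ (r : ℕ) (b : Fin r → (Fin n → ℕ) → F), r ≤ W ∧
      rowSpace f (readBefore σ i) ≤ span F (Set.range b) ∧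
      (i ≠ Fin.last n → ∀ a, b a ∈ rowSpace f (readBefore σ i)) ∧
      (i = 0 → r = 1 ∧ ∀ a, b a = coef f) ∧ (i = Fin.last n → r = 1 ∧ ∀ a, b a = 1) := by
    intro i
    have h0 : (0 : Fin (n + 1)) ≠ Fin.last n := by
      rw [Ne, Fin.ext_iff]
      simp [hn.ne]
    by_cases hi : i = 0
    · subst hi
      have e : ∀ u, cut f (readBefore σ 0) u = coef f := fun u => by
        have : readBefore σ 0 = ∅ := by ext; simp
        funext v
        rw [cut, this, Finset.piecewise_empty]
      refine ⟨1, fun _ => coef f, hW, ?_, fun _ _ => ?_, fun _ => ⟨rfl, fun _ => rfl⟩,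
        fun h => absurd h h0⟩
      · rw [rowSpace, span_le]
        rintro _ ⟨u, rfl⟩
        exact subset_span ⟨0, (e u).symm⟩
      · exact subset_span ⟨0, e 0⟩
    by_cases hl : i = Fin.last n
    · subst hl
      refine ⟨1, fun _ => 1, hW, ?_, fun h => absurd rfl h, fun h => absurd h.symm h0,
        fun _ => ⟨rfl, fun _ => rfl⟩⟩
      rw [rowSpace, span_le]
      rintro _ ⟨u, rfl⟩
      have e : cut f (readBefore σ (Fin.last n)) u = coef f u • (1 : (Fin n → ℕ) → F) := by
        have : readBefore σ (Fin.last n) = Finset.univ := by ext; simp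
        funext v
        rw [cut, this, Finset.piecewise_univ, Pi.smul_apply, Pi.one_apply, smul_eq_mul, mul_one]
      rw [e]
      exact smul_mem _ _ (subset_span ⟨0, rfl⟩)
    · refine ⟨_, fun a => finBasis F (rowSpace f (readBefore σ i)) a, h i, ?_,
        fun _ a => (finBasis F (rowSpace f (readBefore σ i)) a).2, fun h => absurd h hi,
        fun h => absurd h hl⟩
      have := congrArg (Submodule.map (rowSpace f (readBefore σ i)).subtype)
        (finBasis F (rowSpace f (readBefore σ i))).span_eq
      rw [map_span, ← Set.range_comp, map_subtype_top] at this
      exact this.ge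
  choose r b hr hspan hmem hzero hlast using hbase
  have hT : ∀ (i : Fin n) (e : ℕ) (a : Fin (r i.castSucc)), ∃ T : Fin (r i.succ) → F,
      ∑ c, T c • b i.succ c = fun v => b i.castSucc a (Function.update v (σ i) e) := by
    intro i e a
    rw [← mem_span_range_iff_exists_fun]
    exact hspan _ (restrict_mem_rowSpace f σ i e (hmem _ (Fin.castSucc_lt_last i).ne a))
  choose T hT using hT
  have hcoeff : ∀ i a c e, (∑ e ∈ Finset.range (d + 1), Polynomial.monomial e (T i e a c)).coeff e
      = if e < d + 1 then T i e a c else 0 := by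
    intro i a c e
    simp only [Polynomial.finsetSum_coeff, Polynomial.coeff_monomial]
    simp
  let R : ROABP F n d :=
    { layerSize := r
      source := (hzero 0 rfl).1
      sink := (hlast _ rfl).1
      weight := fun i a c => ∑ e ∈ Finset.range (d + 1), Polynomial.monomial e (T i e a c)
      natDegree_le := fun i a c => Polynomial.natDegree_sum_le_of_forall_le _ _ fun e he =>
        (Polynomial.natDegree_monomial_le _).trans (Nat.le_of_lt_succ (Finset.mem_range.mp he)) }
  refine ⟨R.width, Finset.sup_le fun i _ => hr i, R, ?_, rfl⟩
  have key : ∀ w, coef (R.poly σ) w = coef f w := by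
    intro w
    rw [R.coef_poly σ w (fun i a => b i a w) ?_ fun a => by rw [(hlast _ rfl).2 a]; rfl]
    · have h1 : R.layerSize 0 = 1 := R.source
      have : ∀ a : Fin (R.layerSize 0), b 0 a w = coef f w := fun a => by rw [(hzero 0 rfl).2 a]
      simp [this, h1]
    · intro i a
      change b i.castSucc a w = ∑ c, Polynomial.coeff
        (∑ e ∈ Finset.range (d + 1), Polynomial.monomial e (T i e a c)) (w (σ i)) * b i.succ c w
      simp only [hcoeff]
      split_ifs with hw
      · have := congrFun (hT i (w (σ i)) a) w
        simp only [Function.update_eq_self, Finset.sum_apply, Pi.smul_apply, smul_eq_mul] at this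
        exact this.symm
      -- The labels have no coefficients beyond degree `d`; there the functions in the row space
      -- vanish as well.
      · simp only [zero_mul, Finset.sum_const_zero]
        have hle : rowSpace f (readBefore σ i.castSucc)
            ≤ LinearMap.ker (LinearMap.proj w : ((Fin n → ℕ) → F) →ₗ[F] F) := by
          rw [rowSpace, span_le]
          rintro _ ⟨u, rfl⟩
          exact coef_eq_zero (hf (σ i)) (by simp [Finset.piecewise]; omega)
        exact hle (hmem _ (Fin.castSucc_lt_last i).ne a)
  ext m
  have := key m
  simpa [coef] using this

/-- An order that is `α`-approximate for a tensor power is better than that for the polynomial. -/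
theorem IsApproxOrder.of_tensorPow (hn : 0 < n) {d k : ℕ} {f : MvPolynomial (Fin n) F}
    (hf : ∀ i, f.degreeOf i ≤ d) {σ : Equiv.Perm (Fin n)} {α β : ℝ} (hβ : 0 ≤ β)
    (hαβ : α ≤ β ^ (k + 1))
    (h : IsApproxOrder α ((d + 1) ^ (k + 1)) (tensorPow (d + 1) (k + 1) f) σ) :
    IsApproxOrder β d f σ := by
  classical
  obtain ⟨wStar, wOpt, hStar, hOpt, hle⟩ := h
  -- The maximum with 1 is for the zero polynomial, whose ranks are all 0, while the source alone
  -- forces width 1.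
  set W := max 1 (Finset.univ.sup fun i => finrank F (rowSpace f (readBefore σ i)))
  have hW : W ^ (k + 1) ≤ wStar := by
    rcases le_total (Finset.univ.sup fun i => finrank F (rowSpace f (readBefore σ i))) 1 with h | h
    · rw [show W = 1 from max_eq_left h, one_pow]
      exact hStar.one_le
    · obtain ⟨i, -, hi⟩ := Finset.exists_mem_eq_sup Finset.univ Finset.univ_nonempty
        fun i => finrank F (rowSpace f (readBefore σ i))
      rw [show W = _ from max_eq_right h, hi, ← finrank_rowSpace_tensorPow hf]
      exact hStar.finrank_le i
  obtain ⟨w, hw, hROABP⟩ := exists_hasROABP hn hf σ (le_max_left 1 _ : 1 ≤ W) fun i =>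
    (Finset.le_sup (f := fun i => finrank F (rowSpace f (readBefore σ i)))
      (Finset.mem_univ i)).trans (le_max_right _ _)
  have hne : ∃ w', ∃ τ : Equiv.Perm (Fin n), HasROABP d f τ w' := ⟨w, σ, hROABP⟩
  obtain ⟨τ, hτ⟩ := Nat.find_spec hne
  refine ⟨w, Nat.find hne, hROABP, ⟨Nat.find_spec hne, fun w' hw' => Nat.find_min' hne hw'⟩, ?_⟩
  -- An optimal order `τ` for `f` bounds the optimum of the tensor power from above by the power of
  -- the optimum of `f`.
  obtain ⟨v, hv, hvROABP⟩ := exists_hasROABP hn (fun i => degreeOf_tensorPow_le (hf i) (k + 1)) τ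
    (Nat.one_le_pow (k + 1) _ hτ.one_le) fun i => by
      rw [finrank_rowSpace_tensorPow hf]
      exact Nat.pow_le_pow_left (hτ.finrank_le i) _
  have hopt : wOpt ≤ Nat.find hne ^ (k + 1) := (hOpt.2 ⟨τ, hvROABP⟩).trans hv
  have hfin : (w : ℝ) ^ (k + 1) ≤ (β * Nat.find hne) ^ (k + 1) := by
    have h₁ : (w : ℝ) ^ (k + 1) ≤ wStar := by
      exact_mod_cast (Nat.pow_le_pow_left hw _).trans hW
    have h₂ : (wOpt : ℝ) ≤ (Nat.find hne : ℝ) ^ (k + 1) := by exact_mod_cast hopt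
    rw [mul_pow]
    calc (w : ℝ) ^ (k + 1) ≤ α * wOpt := h₁.trans hle
      _ ≤ β ^ (k + 1) * wOpt := by gcongr
      _ ≤ β ^ (k + 1) * (Nat.find hne : ℝ) ^ (k + 1) := by gcongr
  exact le_of_pow_le_pow_left₀ k.succ_ne_zero (by positivity) hfin

end Nisan

end OrderFinding
namespace OrderFinding

open Function

/-! ### Rules for the runs of programs -/

namespace Prog

variable {R : Type} [DecidableEq R]

/-- Sequential execution of a list of programs. -/
def seqs : List (Prog R) → Prog R
  | [] => skip
  | p :: l => seq p (seqs l)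

/-- Add the length of `x` to the counter `y`. -/
def count (x y : R) : Prog R := each x fun _ => push y .tally

/-- Move the letters of `x` to `y`, which reverses their order. -/
def move (x y : R) : Prog R := consume x (fun _ => false) fun a => push y a

/-- Empty the register `x`. -/
def clear (x : R) : Prog R := consume x (fun _ => false) fun _ => skip

theorem Runs.mono {p : Prog R} {t t' : ℕ} {s s' : R → List Letter} (h : p.Runs t s s')
    (ht : t ≤ t') : p.Runs t' s s' := by
  cases p with
  | skip => exact ⟨h.1, h.2.trans ht⟩
  | push x a => exact ⟨h.1, h.2.trans ht⟩
  | drop x => exact ⟨h.1, h.2.trans ht⟩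
  | seq p q =>
      obtain ⟨t₁, t₂, u, h₁, h₂, h₃⟩ := h
      exact ⟨t₁, t₂, u, h₁, h₂, h₃.trans ht⟩
  | each x body =>
      obtain ⟨t₁, h₁, h₂⟩ := h
      exact ⟨t₁, h₁, h₂.trans ht⟩
  | consume x halts body =>
      obtain ⟨t₁, h₁, h₂⟩ := h
      exact ⟨t₁, h₁, h₂.trans ht⟩

theorem Runs.congr {p : Prog R} {t t' : ℕ} {s u s' : R → List Letter} (h : p.Runs t s u)
    (hs : u = s') (ht : t ≤ t') : p.Runs t' s s' :=
  hs ▸ h.mono ht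

/-- Loops are verified by exhibiting the state `st i` after `i` letters, together with a uniform
time bound for the body. -/
theorem iterates_of_family {X : Type} {Step : Letter → ℕ → X → X → Prop} {t : ℕ} :
    ∀ (l : List Letter) (st : ℕ → X),
      (∀ i a, l[i]? = some a → Step a t (st i) (st (i + 1))) →
      Iterates Step l (l.length * (t + 2)) (st 0) (st l.length) := by
  intro l
  induction l with
  | nil =>
      intro st _
      rw [List.length_nil, zero_mul]
      exact .nil _
  | cons a l ih =>
      intro st h
      have h1 := ih (fun i => st (i + 1)) fun i b hb => h (i + 1) b (by simpa using hb)
      rw [List.length_cons, Nat.succ_mul, add_comm]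
      exact .cons (h 0 a rfl) h1

theorem Runs.each_family {x : R} {body : Letter → Prog R} {t m : ℕ} {s : R → List Letter}
    (st : ℕ → R → List Letter) (h0 : st 0 = s) (hm : (s x).length = m)
    (h : ∀ i a, (s x)[i]? = some a → (body a).Runs t (st i) (st (i + 1))) :
    (each x body).Runs (m * (t + 2) + 2) s (st m) := by
  subst h0 hm
  exact ⟨_, iterates_of_family _ st h, le_rfl⟩

theorem Runs.consume_family {x : R} {halts : Letter → Bool} {body : Letter → Prog R} {t : ℕ}
    {s : R → List Letter} (w r : List Letter) (hx : s x = w ++ r)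
    (hw : ∀ a ∈ w, halts a = false) (hr : ∀ a ∈ r.head?, halts a = true)
    (st : ℕ → R → List Letter) (h0 : st 0 = update s x r.tail)
    (h : ∀ i a, w[i]? = some a → (body a).Runs t (st i) (st (i + 1))) :
    (consume x halts body).Runs (w.length * (t + 2) + 1) s (st w.length) := by
  have hr' : r.takeWhile (fun a => !halts a) = [] ∧ r.dropWhile (fun a => !halts a) = r := by
    cases r with
    | nil => simp
    | cons a r => simp [hr a rfl]
  refine ⟨w.length * (t + 2), ?_, le_rfl⟩
  rw [hx, List.takeWhile_append_of_pos (by simpa using hw),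
    List.dropWhile_append_of_pos (by simpa using hw), hr'.1, hr'.2, List.append_nil, ← h0]
  exact iterates_of_family _ st h

section Bounds

variable {M : ℕ} (hM : 1 ≤ M) {h : ℕ}
include hM

theorem Runs.raise {p : Prog R} {c h' : ℕ} {s s' : R → List Letter}
    (hp : p.Runs (c * M ^ h) s s') (hh : h ≤ h') : p.Runs (c * M ^ h') s s' :=
  hp.mono (Nat.mul_le_mul_left _ (Nat.pow_le_pow_right hM hh))

theorem runs_nil (s : R → List Letter) : (seqs []).Runs (1 * M ^ h) s s :=
  ⟨rfl, by simpa using Nat.one_le_pow _ _ hM⟩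

theorem runs_push (x : R) (a : Letter) (s : R → List Letter) :
    (push x a).Runs (1 * M ^ h) s (update s x (a :: s x)) :=
  ⟨rfl, by simpa using Nat.one_le_pow _ _ hM⟩

theorem runs_drop (x : R) (s : R → List Letter) :
    (drop x).Runs (1 * M ^ h) s (update s x (s x).tail) :=
  ⟨rfl, by simpa using Nat.one_le_pow _ _ hM⟩

omit hM in
theorem Runs.cons {p : Prog R} {l : List (Prog R)} {c₁ c₂ : ℕ} {s u s' : R → List Letter}
    (h₁ : p.Runs (c₁ * M ^ h) s u) (h₂ : (seqs l).Runs (c₂ * M ^ h) u s') :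
    (seqs (p :: l)).Runs ((c₁ + c₂) * M ^ h) s s' :=
  ⟨_, _, u, h₁, h₂, (add_mul _ _ _).ge⟩

/-- Times are kept in the form `c * M ^ h`, where `M` bounds the length of the loop: a loop raises
`h` by 1 and `c` by 4, and sequencing adds the constants at a common `h`. -/
theorem Runs.each_bound {x : R} {body : Letter → Prog R} {c m : ℕ} {s : R → List Letter}
    (st : ℕ → R → List Letter) (h0 : st 0 = s) (hm : (s x).length = m) (hmM : m ≤ M)
    (hb : ∀ i a, i < m → (s x)[i]? = some a → (body a).Runs (c * M ^ h) (st i) (st (i + 1))) :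
    (each x body).Runs ((c + 4) * M ^ (h + 1)) s (st m) := by
  refine (Runs.each_family st h0 hm fun i a hi =>
    hb i a (hm ▸ (List.getElem?_eq_some_iff.mp hi).1) hi).mono ?_
  have h₁ : m * (c * M ^ h + 2) ≤ M * (c * M ^ h + 2) := Nat.mul_le_mul_right _ hmM
  have h₂ : M ≤ M ^ (h + 1) := Nat.le_self_pow (Nat.succ_ne_zero h) M
  have h₃ : M * (c * M ^ h + 2) = c * M ^ (h + 1) + 2 * M := by ring
  rw [add_mul]
  omega

theorem runs_count {x y : R} {s : R → List Letter} {m : ℕ}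
    (hx : s x = encodeUnary m) (hm : m ≤ M) :
    (count x y).Runs (5 * M ^ 1) s (update s y (encodeUnary m ++ s y)) := by
  refine Runs.each_bound hM (c := 1) (h := 0) (fun i => update s y (encodeUnary i ++ s y))
    (by simp [encodeUnary]) (by simp [hx, encodeUnary]) hm fun i a _ _ => ?_
  refine (runs_push hM y .tally _).congr ?_ le_rfl
  rw [update_idem, update_self]
  rfl

omit hM in
theorem runs_move_length {x y : R} (hxy : x ≠ y) (s : R → List Letter) :
    (move x y).Runs (3 * (s x).length + 1) s
      (update (update s x []) y ((s x).reverse ++ s y)) := by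
  have := Runs.consume_family (x := x) (halts := fun _ => false) (body := fun a => push y a)
    (t := 1) (s := s) (s x) [] (by simp) (by simp) (by simp)
    (fun i => update (update s x []) y (((s x).take i).reverse ++ s y))
    (by simp [update_of_ne hxy.symm]) (fun i a hi => by
      refine ⟨?_, le_rfl⟩
      rw [update_idem, update_self, List.take_add_one, hi]
      simp)
  rw [List.take_length] at this
  exact this.mono (by omega)

theorem runs_move {x y : R} (hxy : x ≠ y) {s : R → List Letter} (hm : (s x).length ≤ M) :
    (move x y).Runs (5 * M ^ 1) s (update (update s x []) y ((s x).reverse ++ s y)) :=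
  (runs_move_length hxy s).mono (by rw [pow_one]; omega)

theorem runs_clear (x : R) {s : R → List Letter} (hm : (s x).length ≤ M) :
    (clear x).Runs (5 * M ^ 1) s (update s x []) := by
  have := Runs.consume_family (x := x) (halts := fun _ => false) (body := fun _ => skip)
    (t := 1) (s := s) (s x) [] (by simp) (by simp) (by simp)
    (fun _ => update s x []) (by simp) (fun i a hi => ⟨rfl, le_rfl⟩)
  exact this.mono (by rw [pow_one]; omega)

end Bounds

end Prog

end OrderFinding
namespace OrderFinding

open Function

/-! ### The program for the reduction -/

theorem encodeUnary_append (a b : ℕ) : encodeUnary a ++ encodeUnary b = encodeUnary (a + b) := by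
  simp [encodeUnary]

theorem tally_cons_encodeUnary (a : ℕ) : Letter.tally :: encodeUnary a = encodeUnary (a + 1) := rfl

@[simp] theorem length_encodeUnary (a : ℕ) : (encodeUnary a).length = a := by simp [encodeUnary]

@[simp] theorem reverse_encodeUnary (a : ℕ) : (encodeUnary a).reverse = encodeUnary a := by
  simp [encodeUnary]

@[simp] theorem encodeUnary_zero : encodeUnary 0 = [] := rfl

/-- The letters with which the encoding of a node begins. -/
def Letter.isTag : Letter → Bool
  | .varTag => true
  | .constTag => true
  | .addTag => true
  | .mulTag => true
  | _ => false

/-- The end mark. -/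
def Letter.isEnd : Letter → Bool
  | .endMark => true
  | _ => false

/-- The registers of the reduction. -/
inductive Reg : Type where
  | inp | g | h | n | d | p | q | k | k2 | l | a | r | e | e2 | f | out
  deriving DecidableEq

instance : Fintype Reg where
  elems := {Reg.inp, Reg.g, Reg.h, Reg.n, Reg.d, Reg.p, Reg.q, Reg.k, Reg.k2, Reg.l, Reg.a, Reg.r, Reg.e, Reg.e2, Reg.f, Reg.out}
  complete x := by cases x <;> simp

namespace Prog

/-- Read the input up to the next end mark, and count its letters. -/
def readCount (x : Reg) : Prog Reg := consume Reg.inp Letter.isEnd fun _ => push x .tally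

/-- Read the input into the registers. -/
def parse : Prog Reg :=
  seqs [consume Reg.inp Letter.isEnd fun a =>
      seqs [push Reg.h a, if a.isTag then push Reg.l .tally else skip],
    move Reg.h Reg.g, readCount Reg.n, push Reg.d .tally, readCount Reg.d, readCount Reg.p, readCount Reg.q]

theorem Runs.consume_bound {R : Type} [DecidableEq R] {M : ℕ} (hM : 1 ≤ M) {h : ℕ} {x : R}
    {halts : Letter → Bool} {body : Letter → Prog R} {c : ℕ} {s : R → List Letter}
    (w r : List Letter) (hx : s x = w ++ r)
    (hw : ∀ a ∈ w, halts a = false) (hr : ∀ a ∈ r.head?, halts a = true) (hwM : w.length ≤ M)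
    (st : ℕ → R → List Letter) (h0 : st 0 = Function.update s x r.tail)
    (hb : ∀ i a, w[i]? = some a → (body a).Runs (c * M ^ h) (st i) (st (i + 1))) :
    (consume x halts body).Runs ((c + 4) * M ^ (h + 1)) s (st w.length) := by
  refine (Runs.consume_family w r hx hw hr st h0 hb).mono ?_
  have h₁ : w.length * (c * M ^ h + 2) ≤ M * (c * M ^ h + 2) := Nat.mul_le_mul_right _ hwM
  have h₂ : M ≤ M ^ (h + 1) := Nat.le_self_pow (Nat.succ_ne_zero h) M
  have h₃ : M * (c * M ^ h + 2) = c * M ^ (h + 1) + 2 * M := by ring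
  rw [add_mul]
  omega

theorem runs_readCount {M : ℕ} (hM : 1 ≤ M) {x : Reg} {s : Reg → List Letter}
    {w r : List Letter} (hs : s Reg.inp = w ++ .endMark :: r) (hw : ∀ a ∈ w, a.isEnd = false)
    (hwM : w.length ≤ M) (hx : x ≠ Reg.inp) :
    (readCount x).Runs (5 * M ^ 1) s
      (update (update s Reg.inp r) x (encodeUnary w.length ++ s x)) := by
  refine Runs.consume_bound hM (c := 1) (h := 0) w (.endMark :: r) hs hw (by simp [Letter.isEnd])
    hwM (fun i => update (update s Reg.inp r) x (encodeUnary i ++ s x)) ?_ fun i a _ => ?_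
  · rw [encodeUnary_zero, List.nil_append, List.tail_cons, ← update_of_ne hx r s, update_eq_self]
  · refine (runs_push hM x .tally _).congr ?_ le_rfl
    rw [update_idem, update_self]
    rfl

/-- The contents of the registers after the input has been read. -/
def parsed (G : List Letter) (n d p q : ℕ) : Reg → List Letter
  | .g => G
  | .n => encodeUnary n
  | .d => encodeUnary (d + 1)
  | .p => encodeUnary p
  | .q => encodeUnary q
  | .l => encodeUnary (G.countP Letter.isTag)
  | _ => []

/-- The nodes arrive reversed in `h` and are turned around by the move to `g`, while their tags are
counted in `l`. An extra tally makes `d` hold the base `d + 1`. Of the fraction only the bit lengths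
are kept, so no binary arithmetic is needed. -/
theorem runs_parse {M : ℕ} (hM : 1 ≤ M) {G P Q : List Letter} {n d : ℕ}
    (hG : ∀ a ∈ G, a.isEnd = false) (hP : ∀ a ∈ P, a.isEnd = false)
    (hQ : ∀ a ∈ Q, a.isEnd = false) (hGM : G.length ≤ M) (hnM : n ≤ M) (hdM : d ≤ M)
    (hPM : P.length ≤ M) (hQM : Q.length ≤ M) :
    parse.Runs (40 * M ^ 1)
      (update (fun _ => []) Reg.inp (G ++ .endMark :: (encodeUnary n ++ .endMark ::
        (encodeUnary d ++ .endMark :: (P ++ .endMark :: (Q ++ [.endMark]))))))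
      (parsed G n d P.length Q.length) := by
  have hU : ∀ m, ∀ a ∈ encodeUnary m, a.isEnd = false := fun m a ha => by
    rw [List.eq_of_mem_replicate ha]; rfl
  generalize hr₁ : encodeUnary n ++ .endMark :: (encodeUnary d ++ .endMark ::
    (P ++ .endMark :: (Q ++ [.endMark]))) = r₁
  have h₁ := Runs.consume_bound hM (c := 3) (h := 0) (x := Reg.inp) (halts := Letter.isEnd)
    (body := fun a => seqs [push Reg.h a, if a.isTag then push Reg.l .tally else skip])
    (s := update (fun _ => []) Reg.inp (G ++ .endMark :: r₁)) G (.endMark :: r₁) (by simp) hG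
    (by simp [Letter.isEnd]) hGM
    (fun i => update (update (update (fun _ => []) Reg.inp r₁) Reg.h (G.take i).reverse) Reg.l
      (encodeUnary ((G.take i).countP Letter.isTag)))
    (by funext x; cases x <;> simp) (fun i a hi => by
      have e : (if a.isTag then push Reg.l .tally else skip).Runs (1 * M ^ 0)
          (update (update (update (update (fun _ => []) Reg.inp r₁) Reg.h (G.take i).reverse) Reg.l
            (encodeUnary ((G.take i).countP Letter.isTag))) Reg.h (a :: (G.take i).reverse))
          (update (update (update (fun _ => []) Reg.inp r₁) Reg.h (G.take (i + 1)).reverse) Reg.l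
            (encodeUnary ((G.take (i + 1)).countP Letter.isTag))) := by
        rw [List.take_add_one, hi]
        by_cases ha : a.isTag
        · rw [if_pos ha]
          refine Runs.congr (runs_push hM Reg.l .tally _) ?_ le_rfl
          funext x
          cases x <;> simp [ha, encodeUnary, List.replicate_succ]
        · rw [if_neg ha]
          refine ⟨?_, by simp⟩
          funext x
          cases x <;> simp [ha]
      refine (Runs.cons (runs_push hM Reg.h a _) (Runs.cons ?_ (runs_nil hM _)) :
        (seqs _).Runs ((1 + (1 + 1)) * M ^ 0) _ _)
      rw [update_of_ne (by decide), update_self]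
      exact e)
  rw [List.take_length] at h₁
  subst hr₁
  unfold parse
  refine Runs.congr (Runs.cons h₁ <| Runs.cons (runs_move hM (by decide) (by simpa using hGM)) <|
    Runs.cons (runs_readCount hM (w := encodeUnary n) (by simp; rfl) (hU n) (by simpa) (by decide)) <|
    Runs.cons (runs_push hM Reg.d .tally _) <|
    Runs.cons (runs_readCount hM (w := encodeUnary d) (by simp; rfl) (hU d) (by simpa) (by decide)) <|
    Runs.cons (runs_readCount hM (w := P) (by simp; rfl) hP hPM (by decide)) <|
    Runs.cons (runs_readCount hM (w := Q) (by simp; rfl) hQ hQM (by decide)) <|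
    runs_nil hM _) ?_ (Nat.mul_le_mul_right _ (by norm_num))
  funext x
  cases x <;> simp [parsed, encodeUnary, List.replicate_succ']

/-- Compute the number of copies. -/
def computeCopies (c : ℕ) : Prog Reg :=
  seqs [seqs (List.replicate c (push Reg.q .tally)), each Reg.p fun _ => drop Reg.q, push Reg.k .tally,
    each Reg.q fun _ => seqs [count Reg.k Reg.k2, move Reg.k2 Reg.k]]

theorem runs_replicate_push {M : ℕ} (hM : 1 ≤ M) {h : ℕ} (x : Reg) :
    ∀ (c : ℕ) (s : Reg → List Letter), (seqs (List.replicate c (push x .tally))).Runs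
      ((c + 1) * M ^ h) s (update s x (encodeUnary c ++ s x)) := by
  intro c
  induction c with
  | zero =>
      intro s
      refine (runs_nil hM (h := h) s).congr ?_ (by simp)
      simp
  | succ c ih =>
      intro s
      refine Runs.congr (Runs.cons (runs_push hM x .tally s) (ih _)) ?_
        (Nat.mul_le_mul_right _ (by omega))
      rw [update_idem, update_self]
      simp [encodeUnary, List.replicate_succ']

/-- Dropping from an empty register has no effect, which realises the truncated subtraction. Then
`k` is doubled once for each tally left in `q`. -/
theorem runs_computeCopies {M : ℕ} (hM : 1 ≤ M) (c : ℕ) {s : Reg → List Letter} {p q : ℕ}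
    (hp : s Reg.p = encodeUnary p) (hq : s Reg.q = encodeUnary q) (hk : s Reg.k = []) (hk2 : s Reg.k2 = [])
    (hpM : p ≤ M) (hqM : q + c ≤ M) (hkM : 2 ^ (q + c - p) ≤ M) :
    (computeCopies c).Runs ((c + 30) * M ^ 2) s
      (update (update s Reg.q (encodeUnary (q + c - p))) Reg.k (encodeUnary (2 ^ (q + c - p)))) := by
  have h₁ := runs_replicate_push hM (h := 2) Reg.q c s
  have h₂ := Runs.each_bound hM (c := 1) (h := 0) (x := Reg.p) (body := fun _ => drop Reg.q)
    (s := update s Reg.q (encodeUnary c ++ s Reg.q)) (m := p)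
    (fun i => update s Reg.q (encodeUnary (q + c - i)))
    (by simp [hq, encodeUnary_append, add_comm]) (by simp [hp]) hpM (fun i a _ _ => by
      refine (runs_drop hM Reg.q _).congr ?_ le_rfl
      simp [encodeUnary, Nat.sub_sub])
  have h₃ := runs_push hM (h := 2) Reg.k .tally (update s Reg.q (encodeUnary (q + c - p)))
  have h₄ := Runs.each_bound hM (c := 11) (h := 1) (x := Reg.q)
    (body := fun _ => seqs [count Reg.k Reg.k2, move Reg.k2 Reg.k])
    (s := update (update s Reg.q (encodeUnary (q + c - p))) Reg.k
      (.tally :: update s Reg.q (encodeUnary (q + c - p)) Reg.k)) (m := q + c - p)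
    (fun i => update (update s Reg.q (encodeUnary (q + c - p))) Reg.k (encodeUnary (2 ^ i)))
    (by simp [hk, encodeUnary]) (by simp) (by omega) (fun i a hi _ => by
      have hle : 2 ^ i ≤ M := (Nat.pow_le_pow_right (by norm_num) hi.le).trans hkM
      refine Runs.congr (Runs.cons (runs_count hM (m := 2 ^ i) (by simp) hle) <|
        Runs.cons (runs_move hM (by decide) (by simpa [hk2] using hle)) <|
        runs_nil hM _) ?_ (by norm_num)
      funext x
      cases x <;> simp [hk2, encodeUnary_append, pow_succ, mul_two])
  refine Runs.congr (Runs.cons h₁ <| Runs.cons (h₂.raise hM (h' := 2) (by norm_num)) <| Runs.cons h₃ <|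
    Runs.cons h₄ <| runs_nil hM _) rfl (Nat.mul_le_mul_right _ (by omega))

/-- Compute the new bound on the degree. -/
def computeDegree : Prog Reg :=
  seqs [push Reg.e .tally,
    each Reg.k fun _ => seqs [each Reg.d fun _ => count Reg.e Reg.e2, clear Reg.e, move Reg.e2 Reg.e]]

theorem runs_computeDegree {M : ℕ} (hM : 1 ≤ M) {s : Reg → List Letter} {d k : ℕ}
    (hd : s Reg.d = encodeUnary (d + 1)) (hk : s Reg.k = encodeUnary k) (he : s Reg.e = [])
    (he2 : s Reg.e2 = []) (hdM : d + 1 ≤ M) (hkM : k ≤ M) (hM' : (d + 1) ^ k ≤ M) :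
    computeDegree.Runs (30 * M ^ 3) s (update s Reg.e (encodeUnary ((d + 1) ^ k))) := by
  have hle : ∀ i ≤ k, (d + 1) ^ i ≤ M := fun i hi =>
    (Nat.pow_le_pow_right (by omega) hi).trans hM'
  have h₁ := Runs.each_bound hM (c := 20) (h := 2) (x := Reg.k)
    (body := fun _ => seqs [each Reg.d fun _ => count Reg.e Reg.e2, clear Reg.e, move Reg.e2 Reg.e])
    (s := update s Reg.e (.tally :: s Reg.e)) (m := k)
    (fun i => update s Reg.e (encodeUnary ((d + 1) ^ i)))
    (by simp [he, encodeUnary]) (by simp [hk]) hkM (fun i a hi _ => by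
      have h₂ := Runs.each_bound hM (c := 5) (h := 1) (x := Reg.d) (body := fun _ => count Reg.e Reg.e2)
        (s := update s Reg.e (encodeUnary ((d + 1) ^ i))) (m := d + 1)
        (fun j => update (update s Reg.e (encodeUnary ((d + 1) ^ i))) Reg.e2
          (encodeUnary (j * (d + 1) ^ i)))
        (by funext x; cases x <;> simp [he2]) (by simp [hd]) hdM (fun j a _ _ => by
          refine (runs_count hM (m := (d + 1) ^ i) (by simp) (hle i hi.le)).congr ?_ le_rfl
          rw [update_idem, update_self, encodeUnary_append]
          congr 2
          ring)
      refine Runs.congr (Runs.cons h₂ <|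
        Runs.cons ((runs_clear hM Reg.e (by simpa using hle i hi.le)).raise hM (by norm_num)) <|
        Runs.cons ((runs_move hM (by decide) ?_).raise hM (by norm_num)) <|
        runs_nil hM _) ?_ (by norm_num)
      · simpa [pow_succ'] using hle (i + 1) hi
      · funext x
        cases x <;> simp [he2, pow_succ'])
  exact Runs.congr (Runs.cons (runs_push hM Reg.e .tally s) <| Runs.cons h₁ <| runs_nil hM _) rfl
    (Nat.mul_le_mul_right _ (by norm_num))

end Prog

end OrderFinding
namespace OrderFinding

open Function

/-! ### Writing the encoding of the product circuit -/

theorem length_encodeList_le {M : ℕ} {l : List ℕ} (h : ∀ t ∈ l, t ≤ M) :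
    (encodeList l).length ≤ l.length * (M + 1) := by
  induction l with
  | nil => simp [encodeList]
  | cons t l ih =>
      have h₁ := ih fun t ht => h t (List.mem_cons_of_mem _ ht)
      have h₂ := h t List.mem_cons_self
      simp only [encodeList, List.flatMap_cons, List.length_append, List.length_cons,
        length_encodeUnary] at h₁ ⊢
      rw [add_mul]
      omega

theorem encodeList_append (l l' : List ℕ) :
    encodeList (l ++ l') = encodeList l ++ encodeList l' := by
  simp [encodeList]

theorem encodeList_cons (t : ℕ) (l : List ℕ) :
    encodeList (t :: l) = .item :: (encodeUnary t ++ encodeList l) := rfl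

/-- The positions descend because the register `f` collects them by pushing in front. -/
theorem outputPositions_succ (b L k : ℕ) :
    outputPositions b L (k + 1) = (b + (k + 1) * L - 1) :: outputPositions b L k := by
  simp [outputPositions, List.range_succ]

namespace Prog

/-- Write the nodes for the variables. -/
def emitVars : Prog Reg :=
  each .n fun _ => seqs [push .out .varTag, count .r .out, push .r .tally]

theorem runs_emitVars {M : ℕ} (hM : 1 ≤ M) {s : Reg → List Letter} {n : ℕ}
    (hn : s Reg.n = encodeUnary n) (hr : s Reg.r = []) (hnM : n ≤ M) :
    emitVars.Runs (12 * M ^ 2) s (update (update s Reg.r (encodeUnary n)) Reg.out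
      (((List.range n).flatMap fun i => Letter.varTag :: encodeUnary i).reverse ++ s Reg.out)) := by
  refine Runs.each_bound hM (c := 8) (h := 1) (x := Reg.n)
    (fun i => update (update s Reg.r (encodeUnary i)) Reg.out
      (((List.range i).flatMap fun i => Letter.varTag :: encodeUnary i).reverse ++ s Reg.out))
    ?_ (by simp [hn]) hnM fun i a hi _ => ?_
  · funext x; cases x <;> simp [hr]
  · refine Runs.congr (Runs.cons (runs_push hM Reg.out .varTag _) <|
      Runs.cons (runs_count hM (m := i) (by simp) (by omega)) <|
      Runs.cons (runs_push hM Reg.r .tally _) <| runs_nil hM _) ?_ (by norm_num)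
    funext x
    cases x <;> simp [List.range_succ, tally_cons_encodeUnary]

/-- Write the nodes for the powers of the variables, and compute the position where they end. -/
def emitPowers : Prog Reg :=
  seqs [each .k fun _ => each .n fun _ => seqs [push .out .mulTag,
    each .d (fun _ => seqs [push .out .item, count .r .out]), push .r .tally], count .n .r]

/-- The position in `r` runs on through both outer loops, as `j * n + i`. It ends at `k * n`, and
adding `n` gives the number of nodes written so far, where the first copy will start. -/
theorem runs_emitPowers {M : ℕ} (hM : 1 ≤ M) {s : Reg → List Letter} {n d k : ℕ}
    (hn : s Reg.n = encodeUnary n) (hd : s Reg.d = encodeUnary (d + 1))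
    (hk : s Reg.k = encodeUnary k) (hr : s Reg.r = []) (hdM : d + 1 ≤ M) (hnM : n ≤ M)
    (hkM : k ≤ M) (hknM : (k + 1) * n ≤ M) :
    emitPowers.Runs (30 * M ^ 4) s (update (update s Reg.r (encodeUnary ((k + 1) * n))) Reg.out
      (((List.range (k * n)).flatMap fun r =>
        Letter.mulTag :: encodeList (List.replicate (d + 1) r)).reverse ++ s Reg.out)) := by
  let W : ℕ → List Letter := fun r => .mulTag :: encodeList (List.replicate (d + 1) r)
  let st : ℕ → Reg → List Letter := fun i => update (update s Reg.r (encodeUnary i)) Reg.out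
    (((List.range i).flatMap W).reverse ++ s Reg.out)
  have h₁ : ∀ i ≤ M, (seqs [push Reg.out .mulTag,
      each Reg.d (fun _ => seqs [push Reg.out .item, count Reg.r Reg.out]),
      push Reg.r .tally]).Runs (15 * M ^ 2) (st i) (st (i + 1)) := by
    intro i hi
    have h₂ := Runs.each_bound hM (c := 7) (h := 1) (x := Reg.d)
      (body := fun _ => seqs [push Reg.out .item, count Reg.r Reg.out])
      (s := update (st i) Reg.out (.mulTag :: st i Reg.out)) (m := d + 1)
      (fun j => update (st i) Reg.out
        ((encodeList (List.replicate j i)).reverse ++ .mulTag :: st i Reg.out))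
      (by simp [encodeList]) (by simp [st, hd]) hdM (fun j a _ _ => by
        refine Runs.congr (Runs.cons (runs_push hM Reg.out .item _) <|
          Runs.cons (runs_count hM (m := i) (by simp [st]) hi) <| runs_nil hM _) ?_ (by norm_num)
        funext x
        cases x <;> simp [List.replicate_succ', encodeList_append, encodeList_cons]
        simp [encodeList])
    refine Runs.congr (Runs.cons (runs_push hM Reg.out .mulTag (st i)) <| Runs.cons h₂ <|
      Runs.cons (runs_push hM Reg.r .tally _) <| runs_nil hM _) ?_
      (Nat.mul_le_mul_right _ (by norm_num))
    funext x
    cases x <;> simp [st, W, List.range_succ, tally_cons_encodeUnary]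
  have h₃ := Runs.each_bound hM (c := 19) (h := 3) (x := Reg.k)
    (body := fun _ => each Reg.n fun _ => seqs [push Reg.out .mulTag,
      each Reg.d (fun _ => seqs [push Reg.out .item, count Reg.r Reg.out]), push Reg.r .tally])
    (s := s) (m := k) (fun j => st (j * n))
    (by funext x; cases x <;> simp [st, hr]) (by simp [hk]) hkM (fun j a hj _ => by
      have := Runs.each_bound hM (c := 15) (h := 2) (x := Reg.n)
        (body := fun _ => seqs [push Reg.out .mulTag,
          each Reg.d (fun _ => seqs [push Reg.out .item, count Reg.r Reg.out]), push Reg.r .tally])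
        (s := st (j * n)) (m := n) (fun i => st (j * n + i)) rfl (by simp [st, hn]) hnM
        (fun i a hi _ => h₁ _ (by
          have : (j + 1) * n ≤ (k + 1) * n := Nat.mul_le_mul_right _ (by omega)
          rw [add_mul] at this
          omega))
      rw [add_mul, one_mul]
      exact this)
  refine Runs.congr (Runs.cons h₃ <|
    Runs.cons ((runs_count hM (m := n) (by simp [st, hn]) hnM).raise hM (by norm_num)) <|
    runs_nil hM _) ?_ (Nat.mul_le_mul_right _ (by norm_num))
  funext x
  cases x <;> simp [st, W, encodeUnary_append]
  congr 1
  ring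

/-- Write a letter of the encoding of a copy of the circuit. -/
def copyLetter : Letter → Prog Reg
  | .varTag => seqs [push .out .mulTag, push .out .item, count .a .out]
  | .item => seqs [push .out .item, count .r .out]
  | x => push .out x

theorem runs_copyLetter {M : ℕ} (hM : 1 ≤ M) {s : Reg → List Letter} {a r : ℕ}
    (ha : s Reg.a = encodeUnary a) (hr : s Reg.r = encodeUnary r) (haM : a ≤ M) (hrM : r ≤ M)
    (x : Letter) :
    (copyLetter x).Runs (8 * M ^ 1) s (update s Reg.out ((x.copy a r).reverse ++ s Reg.out)) := by
  cases x with
  | varTag =>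
      refine Runs.congr (Runs.cons (runs_push hM Reg.out .mulTag s) <|
        Runs.cons (runs_push hM Reg.out .item _) <|
        Runs.cons (runs_count hM (m := a) (by simp [ha]) haM) <| runs_nil hM _) ?_ (by norm_num)
      simp [Letter.copy]
  | item =>
      refine Runs.congr (Runs.cons (runs_push hM Reg.out .item s) <|
        Runs.cons (runs_count hM (m := r) (by simp [hr]) hrM) <| runs_nil hM _) ?_ (by omega)
      simp [Letter.copy]
  | _ => exact Runs.congr (runs_push hM (h := 1) Reg.out _ s) rfl (by omega)

/-- Write the copies of the circuit, and compute the positions of their outputs. -/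
def emitCopies : Prog Reg :=
  each .k fun _ => seqs [each .g copyLetter, count .n .a, count .l .r, drop .r, count .r .f,
    push .f .item, push .r .tally]

theorem runs_emitCopies {M : ℕ} (hM : 1 ≤ M) {s : Reg → List Letter} {G : List Letter}
    {n k b L : ℕ} (hg : s Reg.g = G) (hn : s Reg.n = encodeUnary n) (hk : s Reg.k = encodeUnary k)
    (hl : s Reg.l = encodeUnary L) (hr : s Reg.r = encodeUnary b) (ha : s Reg.a = [])
    (hf : s Reg.f = []) (hb : 0 < b) (hGM : G.length ≤ M) (hnM : n ≤ M) (hkM : k ≤ M)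
    (hLM : L ≤ M) (hknM : k * n ≤ M) (hbM : b + k * L ≤ M) :
    emitCopies.Runs (40 * M ^ 3) s
      (update (update (update (update s Reg.a (encodeUnary (k * n))) Reg.r
        (encodeUnary (b + k * L))) Reg.f (encodeList (outputPositions b L k))) Reg.out
        (((List.range k).flatMap fun j =>
          G.flatMap (Letter.copy (j * n) (b + j * L))).reverse ++ s Reg.out)) := by
  refine Runs.mono (Runs.each_bound hM (c := 36) (h := 2) (x := Reg.k) (fun j =>
    update (update (update (update s Reg.a (encodeUnary (j * n))) Reg.r
        (encodeUnary (b + j * L))) Reg.f (encodeList (outputPositions b L j))) Reg.out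
        (((List.range j).flatMap fun j =>
          G.flatMap (Letter.copy (j * n) (b + j * L))).reverse ++ s Reg.out))
    ?_ (by simp [hk]) hkM fun j _ hj _ => ?_) le_rfl
  · funext x; cases x <;> simp [hr, ha, hf, outputPositions, encodeList]
  generalize hO : ((List.range j).flatMap fun j =>
          G.flatMap (Letter.copy (j * n) (b + j * L))).reverse ++ s Reg.out = O
  have h₀ : (j + 1) * n ≤ k * n := Nat.mul_le_mul_right _ hj
  have h₀' : (j + 1) * L ≤ k * L := Nat.mul_le_mul_right _ hj
  have e₁ : (j + 1) * n = j * n + n := by ring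
  have e₂ : (j + 1) * L = j * L + L := by ring
  let u : Reg → List Letter := update (update (update s Reg.a (encodeUnary (j * n))) Reg.r
    (encodeUnary (b + j * L))) Reg.f (encodeList (outputPositions b L j))
  have h₁ := Runs.each_bound hM (c := 8) (h := 1) (x := Reg.g) (body := copyLetter)
    (s := update u Reg.out O) (m := G.length)
    (fun i => update u Reg.out
      (((G.take i).flatMap (Letter.copy (j * n) (b + j * L))).reverse ++ O))
    (by simp) (by simp [u, hg]) hGM (fun i a _ hi => by
      have hi' : G[i]? = some a := by simpa [u, hg] using hi
      refine Runs.congr (runs_copyLetter hM (a := j * n) (r := b + j * L) (by simp [u])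
        (by simp [u]) (by omega) (by omega) a) ?_ le_rfl
      rw [update_idem, update_self, List.take_add_one, hi']
      simp)
  rw [List.take_length] at h₁
  -- The output of copy `j` stands just before the start of the next copy. So once `r` has been
  -- advanced, one tally is dropped from it while the position is recorded in `f`, and is put back
  -- afterwards.
  refine Runs.congr (Runs.cons h₁ <|
    Runs.cons ((runs_count hM (m := n) (by simp [u, hn]) hnM).raise hM (by norm_num)) <|
    Runs.cons ((runs_count hM (m := L) (by simp [u, hl]) hLM).raise hM (by norm_num)) <|
    Runs.cons (runs_drop hM Reg.r _) <|
    Runs.cons ((runs_count hM (m := b + (j + 1) * L - 1) ?_ (by omega)).raise hM (by norm_num)) <|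
    Runs.cons (runs_push hM Reg.f .item _) <|
    Runs.cons (runs_push hM Reg.r .tally _) <| runs_nil hM _) ?_
      (Nat.mul_le_mul_right _ (by norm_num))
  · simp [u, encodeUnary]
    omega
  · subst hO
    funext x
    cases x <;> simp [u, List.range_succ, encodeUnary_append, outputPositions_succ,
      encodeList_cons, e₁, e₂]
    · congr 1
      ring
    · simp [encodeUnary, ← List.replicate_succ]
      omega

/-- Write the last node and the numbers that follow it. -/
def emitEnd : Prog Reg :=
  seqs [push .out .mulTag, move .f .out, push .out .endMark, count .n .out, push .out .endMark,
    count .e .out, push .out .endMark]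

theorem runs_emitEnd {M : ℕ} (hM : 1 ≤ M) {s : Reg → List Letter} {n D : ℕ}
    (hn : s Reg.n = encodeUnary n) (he : s Reg.e = encodeUnary D) (hnM : n ≤ M) (hDM : D ≤ M)
    (hf : (s Reg.f).length ≤ 2 * M ^ 2) :
    emitEnd.Runs (30 * M ^ 2) s (update (update s Reg.f []) Reg.out
      ((Letter.mulTag :: s Reg.f ++ [Letter.endMark] ++ encodeUnary n ++ [Letter.endMark] ++
        encodeUnary D ++ [Letter.endMark]).reverse ++ s Reg.out)) := by
  -- The list of positions may be longer than `M`, so its actual length is charged: `3 * (2 * M ^ 2)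
  -- + 1 ≤ 7 * M ^ 2`.
  have h₁ := (runs_move_length (x := Reg.f) (y := Reg.out) (by decide)
    (update s Reg.out (.mulTag :: s Reg.out))).mono (t' := 7 * M ^ 2) (by
      have := Nat.one_le_pow 2 M hM
      rw [update_of_ne (by decide)]
      omega)
  refine Runs.congr (Runs.cons (runs_push hM Reg.out .mulTag s) <| Runs.cons h₁ <|
    Runs.cons (runs_push hM Reg.out .endMark _) <|
    Runs.cons ((runs_count hM (m := n) (by simp [hn]) hnM).raise hM (by norm_num)) <|
    Runs.cons (runs_push hM Reg.out .endMark _) <|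
    Runs.cons ((runs_count hM (m := D) (by simp [he]) hDM).raise hM (by norm_num)) <|
    Runs.cons (runs_push hM Reg.out .endMark _) <| runs_nil hM _) ?_
      (Nat.mul_le_mul_right _ (by norm_num))
  funext x
  cases x <;> simp

/-- Empty the registers. -/
def cleanup : Prog Reg :=
  seqs [clear .g, clear .n, clear .d, clear .p, clear .q, clear .k, clear .l, clear .a, clear .r,
    clear .e]

/-- The reduction: write the input for a product of expansions. -/
def reduce (c : ℕ) : Prog Reg :=
  seqs [parse, computeCopies c, computeDegree, emitVars, clear .r, emitPowers, emitCopies, emitEnd,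
    cleanup]

theorem touches_copyLetter (a : Letter) (x : Reg) (h : (copyLetter a).Touches x) :
    x = Reg.out ∨ x = Reg.a ∨ x = Reg.r := by
  cases a <;> simp [copyLetter, seqs, Touches, count] at h <;> tauto

theorem ok_copyLetter (a : Letter) : (copyLetter a).Ok := by
  cases a <;> simp [copyLetter, seqs, Ok, Touches, count]

theorem ok_reduce (c : ℕ) : (reduce c).Ok := by
  have h₁ : ∀ l : List (Prog Reg), (∀ p ∈ l, p.Ok) → (seqs l).Ok := by
    intro l
    induction l with
    | nil => intro _; trivial
    | cons p l ih => exact fun h => ⟨h p List.mem_cons_self, ih fun q hq =>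
        h q (List.mem_cons_of_mem _ hq)⟩
  have hpush : (seqs (List.replicate c (push Reg.q .tally))).Ok :=
    h₁ _ fun p hp => by rw [List.eq_of_mem_replicate hp]; trivial
  have hparse : ∀ a : Letter, ¬ (if a.isTag then push Reg.l .tally else skip).Touches Reg.inp ∧
      (if a.isTag then push Reg.l .tally else skip).Ok := by
    intro a
    split_ifs <;> simp [Touches, Ok]
  have hcopy : ∀ a, ¬ (copyLetter a).Touches Reg.g := fun a h => by
    simpa using touches_copyLetter a _ h
  have hcopy' : ∀ a, ¬ (copyLetter a).Touches Reg.k := fun a h => by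
    simpa using touches_copyLetter a _ h
  simp [reduce, seqs, Ok, Touches, parse, computeCopies, computeDegree, emitVars, emitPowers,
    emitCopies, emitEnd, cleanup, clear, move, count, readCount, hpush, hparse, hcopy, hcopy',
    ok_copyLetter]

end Prog

end OrderFinding
namespace OrderFinding

open Function

/-! ### Correctness and running time of the reduction -/

namespace Prog

theorem runs_cleanup {M : ℕ} (hM : 1 ≤ M) {s : Reg → List Letter}
    (hs : ∀ x, x ≠ Reg.f → x ≠ Reg.out → (s x).length ≤ M) (hinp : s Reg.inp = [])
    (hh : s Reg.h = []) (hk2 : s Reg.k2 = []) (he2 : s Reg.e2 = []) (hf : s Reg.f = []) :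
    cleanup.Runs (60 * M ^ 1) s (update (fun _ => []) Reg.out (s Reg.out)) := by
  have hc : ∀ (x : Reg) (u : Reg → List Letter), (u x).length ≤ M →
      (clear x).Runs (5 * M ^ 1) u (update u x []) := fun x u hu => runs_clear hM x hu
  unfold cleanup
  refine Runs.congr (Runs.cons (hc Reg.g s (hs _ (by decide) (by decide))) <|
    Runs.cons (hc Reg.n _ ?_) <| Runs.cons (hc Reg.d _ ?_) <| Runs.cons (hc Reg.p _ ?_) <|
    Runs.cons (hc Reg.q _ ?_) <| Runs.cons (hc Reg.k _ ?_) <| Runs.cons (hc Reg.l _ ?_) <|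
    Runs.cons (hc Reg.a _ ?_) <| Runs.cons (hc Reg.r _ ?_) <| Runs.cons (hc Reg.e _ ?_) <|
    runs_nil hM _) ?_ (Nat.mul_le_mul_right _ (by norm_num))
  on_goal 10 => funext x; cases x <;> simp [hinp, hh, hk2, he2, hf]
  all_goals simp [hs]

theorem runs_reduce {M : ℕ} (hM : 1 ≤ M) (c : ℕ) {G P Q : List Letter} {n d k : ℕ}
    (hG : ∀ a ∈ G, a.isEnd = false) (hP : ∀ a ∈ P, a.isEnd = false)
    (hQ : ∀ a ∈ Q, a.isEnd = false) (hk : 2 ^ (Q.length + c - P.length) = k) (hn : 0 < n)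
    (hGM : G.length ≤ M) (hdM : d + 1 ≤ M) (hPM : P.length ≤ M) (hQM : Q.length + c ≤ M)
    (hkM : k ≤ M) (hDM : (d + 1) ^ k ≤ M)
    (hbM : (k + 1) * n + k * G.countP Letter.isTag ≤ M) :
    (reduce c).Runs ((c + 300) * M ^ 4)
      (update (fun _ => []) Reg.inp (G ++ .endMark :: (encodeUnary n ++ .endMark ::
        (encodeUnary d ++ .endMark :: (P ++ .endMark :: (Q ++ [.endMark]))))))
      (update (fun _ => []) Reg.out
        (tensorEncoding G n d (G.countP Letter.isTag) k).reverse) := by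
  have hnM : n ≤ M := by nlinarith
  have hLM : G.countP Letter.isTag ≤ M := List.countP_le_length.trans hGM
  have h₁ := (runs_parse hM hG hP hQ hGM hnM (by omega) hPM (by omega) (n := n) (d := d)).raise hM
    (h' := 4) (by norm_num)
  have h₂ := (runs_computeCopies hM c (s := parsed G n d P.length Q.length) rfl rfl rfl rfl hPM hQM
    (by rw [hk]; exact hkM)).raise hM (h' := 4) (by norm_num)
  rw [hk] at h₂
  have hpos : ∀ t ∈ outputPositions ((k + 1) * n) (G.countP Letter.isTag) k, t ≤ M := by
    intro t ht
    obtain ⟨j, hj, rfl⟩ := List.mem_map.mp ht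
    have hj : j + 1 ≤ k := by simpa using hj
    have := Nat.mul_le_mul_right (G.countP Letter.isTag) hj
    omega
  have hf := length_encodeList_le hpos
  have hf' : (encodeList (outputPositions ((k + 1) * n) (G.countP Letter.isTag) k)).length
      ≤ 2 * M ^ 2 := by
    refine hf.trans ?_
    have : (outputPositions ((k + 1) * n) (G.countP Letter.isTag) k).length = k := by
      simp [outputPositions]
    rw [this]
    nlinarith
  unfold reduce
  refine Runs.congr (Runs.cons h₁ <| Runs.cons h₂ <|
    Runs.cons ((runs_computeDegree hM (d := d) (k := k) (by simp [parsed]) (by simp)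
      (by simp [parsed]) (by simp [parsed]) hdM hkM hDM).raise hM (by norm_num)) <|
    Runs.cons ((runs_emitVars hM (n := n) (by simp [parsed]) (by simp [parsed]) hnM).raise hM
      (by norm_num)) <|
    Runs.cons ((runs_clear hM Reg.r (by simpa using hnM)).raise hM (by norm_num)) <|
    Runs.cons (runs_emitPowers hM (n := n) (d := d) (k := k) (by simp [parsed]) (by simp [parsed])
      (by simp) (by simp) hdM hnM hkM (by omega)) <|
    Runs.cons ((runs_emitCopies hM (G := G) (n := n) (k := k) (b := (k + 1) * n)
      (L := G.countP Letter.isTag) (by simp [parsed]) (by simp [parsed])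
      (by simp) (by simp [parsed]) (by simp) (by simp [parsed]) (by simp [parsed]) (by positivity)
      hGM hnM hkM hLM (by rw [add_mul] at hbM; omega) hbM).raise hM (by norm_num)) <|
    Runs.cons ((runs_emitEnd hM (n := n) (D := (d + 1) ^ k) (by simp [parsed]) (by simp) hnM hDM
      (by simpa using hf')).raise hM (by norm_num)) <|
    Runs.cons ((runs_cleanup hM ?_ (by simp [parsed]) (by simp [parsed]) (by simp [parsed])
      (by simp [parsed]) (by simp)).raise hM (by norm_num)) <| runs_nil hM _) ?_
      (Nat.mul_le_mul_right _ (by omega))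
  · have : k * n ≤ M := by rw [add_mul] at hbM; omega
    intro x h₁ h₂
    cases x <;> simp [parsed] at h₁ h₂ ⊢ <;> first | assumption | omega
  · congr 1
    simp [parsed, tensorEncoding]

end Prog

/-! ### End marks and tags in encodings -/

section Encoding

variable {S : Set (List Bool)}

theorem isEnd_encodeUnary (m : ℕ) : ∀ a ∈ encodeUnary m, a.isEnd = false := fun a ha => by
  rw [List.eq_of_mem_replicate ha]; rfl

theorem isEnd_encodeList (l : List ℕ) : ∀ a ∈ encodeList l, a.isEnd = false := by
  intro a ha
  obtain ⟨t, -, ht⟩ := List.mem_flatMap.mp ha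
  rcases List.mem_cons.mp ht with rfl | ht
  · rfl
  · exact isEnd_encodeUnary t a ht

theorem isEnd_bits (l : List Bool) : ∀ a ∈ l.map Letter.bit, a.isEnd = false := by
  intro a ha
  obtain ⟨b, -, rfl⟩ := List.mem_map.mp ha
  rfl

theorem Gate.isEnd_encode {n : ℕ} (g : Gate S n) : ∀ a ∈ g.encode, a.isEnd = false := by
  intro a ha
  cases g <;> rcases List.mem_cons.mp ha with rfl | ha <;> first | rfl | skip
  · exact isEnd_encodeUnary _ a ha
  · exact isEnd_bits _ a ha
  · exact isEnd_encodeList _ a ha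
  · exact isEnd_encodeList _ a ha

theorem countP_encodeUnary (m : ℕ) : (encodeUnary m).countP Letter.isTag = 0 := by
  rw [List.countP_eq_zero]
  intro a ha
  rw [List.eq_of_mem_replicate ha]
  simp [Letter.isTag]

theorem countP_encodeList (l : List ℕ) : (encodeList l).countP Letter.isTag = 0 := by
  induction l with
  | nil => rfl
  | cons t l ih =>
      rw [encodeList_cons, List.countP_cons, List.countP_append, ih, countP_encodeUnary]
      rfl

/-- This is why counting tags while reading yields the number of nodes of the circuit. -/
theorem Gate.countP_encode {n : ℕ} (g : Gate S n) : g.encode.countP Letter.isTag = 1 := by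
  cases g with
  | var i => rw [Gate.encode, List.countP_cons, countP_encodeUnary]; rfl
  | const c =>
      have : ((c : List Bool).map Letter.bit).countP Letter.isTag = 0 := by
        rw [List.countP_eq_zero]
        intro a ha
        obtain ⟨b, -, rfl⟩ := List.mem_map.mp ha
        simp [Letter.isTag]
      rw [Gate.encode, List.countP_cons, this]
      rfl
  | add l => rw [Gate.encode, List.countP_cons, countP_encodeList]; rfl
  | mul l => rw [Gate.encode, List.countP_cons, countP_encodeList]; rfl

theorem countP_gates {n : ℕ} (gates : List (Gate S n)) :
    (gates.flatMap Gate.encode).countP Letter.isTag = gates.length := by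
  induction gates with
  | nil => rfl
  | cons g gs ih => rw [List.flatMap_cons, List.countP_append, ih, g.countP_encode,
      List.length_cons, add_comm]

end Encoding

/-! ### Polynomial bounds and the number of copies -/

section Estimates

/-- For `x ≥ 2` a coefficient `a` is at most `x ^ a`, and a sum of two powers costs one further
factor `x`. -/
theorem exists_eval_le_pow (p : Polynomial ℕ) : ∃ e : ℕ, ∀ x : ℕ, 2 ≤ x → p.eval x ≤ x ^ e := by
  induction p using Polynomial.induction_on' with
  | add p q hp hq =>
      obtain ⟨a, ha⟩ := hp
      obtain ⟨b, hb⟩ := hq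
      refine ⟨max a b + 1, fun x hx => ?_⟩
      have h₁ := (ha x hx).trans (Nat.pow_le_pow_right (by omega) (le_max_left a b))
      have h₂ := (hb x hx).trans (Nat.pow_le_pow_right (by omega) (le_max_right a b))
      rw [Polynomial.eval_add, pow_succ]
      nlinarith [Nat.zero_le (x ^ max a b)]
  | monomial i a =>
      refine ⟨a + i, fun x hx => ?_⟩
      rw [Polynomial.eval_monomial, pow_add]
      exact Nat.mul_le_mul_right _ (Nat.lt_two_pow_self.le.trans (Nat.pow_le_pow_left hx a))

variable {a b : ℕ}

theorem two_pow_size_le (h : 0 < a) : 2 ^ a.size ≤ 2 * a := by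
  have h₁ : 0 < a.size := Nat.size_pos.mpr h
  have h₂ : 2 ^ (a.size - 1) ≤ a := Nat.lt_size.mp (by omega)
  calc 2 ^ a.size = 2 * 2 ^ (a.size - 1) := by rw [← pow_succ']; congr 1; omega
    _ ≤ 2 * a := Nat.mul_le_mul_left _ h₂

/-- Bit lengths determine numbers up to a factor of 2, and truncation of the subtraction only
enlarges the right-hand side. -/
theorem two_pow_mul_le (ha : 0 < a) (c : ℕ) :
    2 ^ c * b ≤ 2 * (2 ^ (b.size + c - a.size) * a) := by
  calc 2 ^ c * b ≤ 2 ^ c * 2 ^ b.size := Nat.mul_le_mul_left _ (Nat.lt_size_self b).le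
    _ = 2 ^ (b.size + c) := by rw [← pow_add, add_comm]
    _ ≤ 2 ^ ((b.size + c - a.size) + a.size) := Nat.pow_le_pow_right (by norm_num) (by omega)
    _ = 2 ^ (b.size + c - a.size) * 2 ^ a.size := pow_add _ _ _
    _ ≤ 2 ^ (b.size + c - a.size) * (2 * a) := Nat.mul_le_mul_left _ (two_pow_size_le ha)
    _ = 2 * (2 ^ (b.size + c - a.size) * a) := by ring

/-- Bernoulli's inequality: for `k = 2 ^ (b.size + c - a.size)` one has `k * ε ≥ 2 ^ c / 2 ≥ α - 1`.
-/
theorem le_one_add_pow {α ε : ℝ} {c : ℕ} (ha : 0 < a) (hb : 0 < b) (hε : ε = a / b)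
    (hc : 2 * (α - 1) ≤ 2 ^ c) : α ≤ (1 + ε) ^ 2 ^ (b.size + c - a.size) := by
  have hb' : (0 : ℝ) < b := by exact_mod_cast hb
  have hε0 : 0 ≤ ε := by rw [hε]; positivity
  refine le_trans ?_ (one_add_mul_le_pow (by linarith) _)
  have h : (2 : ℝ) ^ c * b ≤ 2 * (2 ^ (b.size + c - a.size) * a) := by
    exact_mod_cast two_pow_mul_le (b := b) ha c
  have h₁ : α - 1 ≤ 2 ^ (b.size + c - a.size) * ε := by
    rw [hε, mul_div_assoc', le_div_iff₀ hb']
    nlinarith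
  push_cast
  linarith

/-- If the subtraction truncates, a single copy is used, which accounts for the 1 in the maximum;
otherwise the bit lengths give a multiple of `b / a = 1 / ε`. -/
theorem two_pow_le_max {ε : ℝ} {c : ℕ} (ha : 0 < a) (hb : 0 < b) (hε : ε = a / b) :
    ((2 ^ (b.size + c - a.size) : ℕ) : ℝ) ≤ 2 ^ (c + 1) * max 1 (1 / ε) := by
  have ha' : (0 : ℝ) < a := by exact_mod_cast ha
  have h2 : (1 : ℝ) ≤ 2 ^ (c + 1) := one_le_pow₀ (by norm_num)
  rcases Nat.le_total (b.size + c) a.size with h | h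
  · rw [Nat.sub_eq_zero_of_le h, pow_zero, Nat.cast_one]
    have := le_max_left 1 (1 / ε)
    nlinarith
  · refine le_trans ?_ (mul_le_mul_of_nonneg_left (le_max_right _ _) (by positivity))
    rw [hε, one_div_div, mul_div_assoc', le_div_iff₀ ha']
    have : 2 ^ (b.size + c - a.size) * a ≤ 2 ^ (c + 1) * b := by
      calc 2 ^ (b.size + c - a.size) * a ≤ 2 ^ (b.size + c - a.size) * 2 ^ a.size :=
            Nat.mul_le_mul_left _ (Nat.lt_size_self a).le
        _ = 2 ^ c * 2 ^ b.size := by rw [← pow_add, ← pow_add]; congr 1; omega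
        _ ≤ 2 ^ c * (2 * b) := Nat.mul_le_mul_left _ (two_pow_size_le hb)
        _ = 2 ^ (c + 1) * b := by ring
    exact_mod_cast this

end Estimates

end OrderFinding
-- Total running time and conclusion
namespace OrderFinding

open Function

/-- The reduction, followed by an algorithm `A` whose running time is bounded by the polynomial
`p`, on an input of length `m`. -/
theorem exists_compose_reduce_outputs {S : Set (List Bool)} (A : Algorithm) (p : Polynomial ℕ)
    (c : ℕ) : ∃ e : ℕ, ∀ (I : Instance S) (hn : 0 < I.n) (ε : ℚ) (k : ℕ) (hk : 0 < k)
      (_ : 2 ^ (ε.den.size + c - ε.num.toNat.size) = k) (z : List Letter),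
      A.OutputsInTime (I.tensor hn hk).encode z (p.eval (I.tensor hn hk).encode.length) →
      ∃ t ≤ (I.encodeWithEps ε).length ^ (e * k),
        (compose (Prog.reduce c) Reg.inp Reg.out A).OutputsInTime (I.encodeWithEps ε) z t := by
  -- The reduction takes time `T`, the transfer of its output at most `T + 1`, and the algorithm `A`
  -- at most `p.eval T`.
  obtain ⟨e, he⟩ := exists_eval_le_pow (p + 2 * Polynomial.X + 1)
  -- Below, `T ≤ m ^ (c + 300) * M ^ 4 = m ^ (5 * c + 312 + 4 * k)`, and this exponent is at most
  -- `(5 * c + 316) * k` because `k ≥ 1`.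
  refine ⟨(5 * c + 316) * e, fun I hn ε k hk hk2 z hA => ?_⟩
  set m := (I.encodeWithEps ε).length with hm
  set G := I.C.gates.flatMap Gate.encode with hG
  set P := (Nat.bits ε.num.toNat).map Letter.bit with hP
  set Q := (Nat.bits ε.den).map Letter.bit with hQ
  have hPlen : P.length = ε.num.toNat.size := by rw [hP, List.length_map, Nat.size_eq_bits_len]
  have hQlen : Q.length = ε.den.size := by rw [hQ, List.length_map, Nat.size_eq_bits_len]
  have hinput : I.encodeWithEps ε = G ++ .endMark :: (encodeUnary I.n ++ .endMark ::
      (encodeUnary I.d ++ .endMark :: (P ++ .endMark :: (Q ++ [.endMark])))) := by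
    simp [Instance.encodeWithEps, Instance.encode, hG, hP, hQ]
  have hlen : m = G.length + I.n + I.d + P.length + Q.length + 5 := by
    rw [hm, hinput]
    simp only [List.length_append, List.length_cons, length_encodeUnary, List.length_nil]
    ring
  have hcount : G.countP Letter.isTag = I.C.gates.length := countP_gates _
  have hLG : G.countP Letter.isTag ≤ G.length := List.countP_le_length
  have hm2 : 2 ≤ m := by omega
  have hpow : ∀ {i j : ℕ}, i ≤ j → m ^ i ≤ m ^ j := fun h => Nat.pow_le_pow_right (by omega) h
  have htwo : ∀ i, i + 1 ≤ m ^ i := fun i =>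
    Nat.lt_two_pow_self.trans_le (Nat.pow_le_pow_left hm2 i)
  -- This bounds every quantity that the reduction handles in unary: `(d + 1) ^ k ≤ m ^ k`, node
  -- positions up to `m ^ (k + 1)`, and `Q.length + c ≤ m ^ (c + 1)`.
  set M := m ^ (k + c + 3) with hM
  have hM1 : 1 ≤ M := Nat.one_le_pow _ _ (by omega)
  have hmM : m ≤ M := by simpa using hpow (show 1 ≤ k + c + 3 by omega)
  have hrun := Prog.runs_reduce hM1 c (G := G) (P := P) (Q := Q) (n := I.n) (d := I.d) (k := k)
    (by
      intro a ha
      obtain ⟨g, -, hg⟩ := List.mem_flatMap.mp ha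
      exact g.isEnd_encode a hg)
    (isEnd_bits _) (isEnd_bits _) (by rw [hPlen, hQlen, hk2]) hn (by omega) (by omega) (by omega)
    (by
      calc Q.length + c ≤ m * (c + 1) := by nlinarith
        _ ≤ m * m ^ c := Nat.mul_le_mul_left _ (htwo c)
        _ = m ^ (c + 1) := (pow_succ' m c).symm
        _ ≤ M := hpow (by omega))
    (by exact (Nat.le_succ k).trans ((htwo k).trans (hpow (by omega))))
    (by exact (Nat.pow_le_pow_left (by omega) k).trans (hpow (by omega)))
    (by
      calc (k + 1) * I.n + k * G.countP Letter.isTag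
          ≤ (k + 1) * (I.n + G.countP Letter.isTag) := by nlinarith
        _ ≤ m ^ k * m := Nat.mul_le_mul (htwo k) (by omega)
        _ = m ^ (k + 1) := (pow_succ m k).symm
        _ ≤ M := hpow (by omega))
  rw [← hinput, hcount, ← I.encode_tensor hn hk] at hrun
  set T := (c + 300) * M ^ 4 with hT
  -- The output of a program is no longer than its running time, so the new input needs no separate
  -- estimate of its length.
  have hylen : (I.tensor hn hk).encode.length ≤ T := by
    have := hrun.length_le Reg.out
    simpa using this
  refine ⟨_, ?_, compose_outputs (Prog.ok_reduce c) hrun hA⟩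
  have hT2 : 2 ≤ T := by
    have := Nat.one_le_pow 4 M hM1
    nlinarith
  have hTm : T ≤ m ^ ((5 * c + 316) * k) := by
    calc T ≤ m ^ (c + 300) * M ^ 4 :=
          Nat.mul_le_mul_right _ ((Nat.le_succ _).trans (htwo (c + 300)))
      _ = m ^ (c + 300 + (k + c + 3) * 4) := by rw [hM, ← pow_mul, ← pow_add]
      _ ≤ m ^ ((5 * c + 316) * k) := hpow (by nlinarith)
  have hmono : p.eval (I.tensor hn hk).encode.length ≤ p.eval T := by
    rw [Polynomial.eval_eq_sum, Polynomial.eval_eq_sum]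
    exact Finset.sum_le_sum fun i _ => Nat.mul_le_mul_left _ (Nat.pow_le_pow_left hylen i)
  calc T + ((I.tensor hn hk).encode.length + 1) + p.eval (I.tensor hn hk).encode.length
      ≤ (p + 2 * Polynomial.X + 1).eval T := by
        simp only [Polynomial.eval_add, Polynomial.eval_mul, Polynomial.eval_X,
          Polynomial.eval_one, Polynomial.eval_ofNat]
        omega
    _ ≤ T ^ e := he T hT2
    _ ≤ (m ^ ((5 * c + 316) * k)) ^ e := Nat.pow_le_pow_left hTm e
    _ = m ^ ((5 * c + 316) * e * k) := by rw [← pow_mul]; congr 1; ring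

end OrderFinding
open OrderFinding in
theorem mainTheorem7 {F : Type*} [Field F] {S : Set (List Bool)} (val : S → F)
    (α : ℝ) (hα : 1 < α)
    (hApproxWidth : ∃ (A : Algorithm) (p : Polynomial ℕ),
      ∀ I : Instance S, I.Valid val →
        ∃ σ : Equiv.Perm (Fin I.n),
          A.OutputsInTime I.encode (encodeOrder σ) (p.eval I.encode.length) ∧
          IsApproxOrder α I.d (I.C.poly val) σ) :
    ∃ (B : Algorithm) (c : ℕ),
      ∀ I : Instance S, I.Valid val → ∀ ε : ℚ, 0 < ε →
        ∃ (σ : Equiv.Perm (Fin I.n)) (t : ℕ),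
          B.OutputsInTime (I.encodeWithEps ε) (encodeOrder σ) t ∧
          IsApproxOrder (1 + (ε : ℝ)) I.d (I.C.poly val) σ ∧
          (t : ℝ) ≤ ((I.encodeWithEps ε).length : ℝ) ^ ((c : ℝ) * max 1 (1 / (ε : ℝ))) := by
  obtain ⟨A, p, hA⟩ := hApproxWidth
  obtain ⟨c, hc⟩ := pow_unbounded_of_one_lt (2 * (α - 1)) (one_lt_two : (1 : ℝ) < 2)
  obtain ⟨e, he⟩ := exists_compose_reduce_outputs (S := S) A p c
  -- The machine is fixed before `ε`, which it reads from the input. The constant arises from the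
  -- time bound `m ^ (e * k)` and `k ≤ 2 ^ (c + 1) * max 1 (1 / ε)`.
  refine ⟨compose (Prog.reduce c) Reg.inp Reg.out A, e * 2 ^ (c + 1), fun I hI ε hε => ?_⟩
  have hnum : 0 < ε.num.toNat := by
    have := Rat.num_pos.mpr hε
    omega
  have hεeq : (ε : ℝ) = (ε.num.toNat : ℝ) / (ε.den : ℝ) := by
    have h : ((ε.num.toNat : ℤ) : ℝ) = (ε.num : ℝ) := by
      rw [Int.toNat_of_nonneg (Rat.num_pos.mpr hε).le]
    rw [Rat.cast_def, ← h, Int.cast_natCast]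
  obtain ⟨k, hk⟩ : ∃ k, 2 ^ (ε.den.size + c - ε.num.toNat.size) = k + 1 :=
    Nat.exists_eq_add_one.mpr (by positivity)
  -- The new instance has the same variables, so the order found for it is already the answer for
  -- `I`.
  obtain ⟨σ, hσ, hσ'⟩ := hA (I.tensor hI.1 k.succ_pos) (hI.tensor k.succ_pos)
  obtain ⟨t, ht, hB⟩ := he I hI.1 ε (k + 1) k.succ_pos hk _ hσ
  refine ⟨σ, t, hB, ?_, ?_⟩
  · rw [Instance.poly_tensor] at hσ'
    have hle := le_one_add_pow (c := c) hnum ε.den_pos hεeq hc.le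
    rw [hk] at hle
    have hε' : (0 : ℝ) < ε := by exact_mod_cast hε
    exact IsApproxOrder.of_tensorPow hI.1 hI.2 (by linarith) hle hσ'
  · have hmax := two_pow_le_max (c := c) hnum ε.den_pos hεeq
    rw [hk] at hmax
    have h1 : (1 : ℝ) ≤ (I.encodeWithEps ε).length := by
      have : 1 ≤ (I.encodeWithEps ε).length := by
        simp only [Instance.encodeWithEps, List.length_append, List.length_singleton]
        omega
      exact_mod_cast this
    calc (t : ℝ) ≤ ((I.encodeWithEps ε).length : ℝ) ^ (e * (k + 1)) := by exact_mod_cast ht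
      _ = ((I.encodeWithEps ε).length : ℝ) ^ ((e : ℝ) * ((k + 1 : ℕ) : ℝ)) := by
          rw [← Real.rpow_natCast, Nat.cast_mul]
      _ ≤ _ := by
          apply Real.rpow_le_rpow_of_exponent_le h1
          push_cast at hmax ⊢
          rw [mul_assoc]
          exact mul_le_mul_of_nonneg_left hmax (Nat.cast_nonneg e)
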